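/- Work at the prime $2$. Let $\mathcal A$ be the mod $2$ Steenrod algebra and let $F_*\to\mathbb F_2$ be a resolution by graded free $\mathcal A$-modules, each $F_i$ having a homogeneous $\mathcal A$-basis $(r^*_{i,j})_j$ (with a chosen linear order on the indices $j$) with only finitely many elements in each degree. Let $X$ be a finite CW spectrum whose cells correspond to a homogeneous basis $(e_k^*)$ of $M=H^*(X;\mathbb F_2)$, linearly ordered so that elements of lower degree come first; write $\dim k=|e_k^*|$. (Only the $\mathcal A$-module $M$ matters; the statement holds for every finite-dimensional graded $\mathcal A$-module $M$ with such a basis.) For integers $m,n$ let $X_m^n$ be the truncation of $X$ to the cells of dimensions $m$ through $n$; its cohomology is $M_m^n=M^{\ge m}/M^{\ge n+1}$, with basis the classes of the $e_k^*$ with $m\le\dim k\le n$. For a graded $\mathcal A$-module $N$ let $C^{i,t}(N)=\mathrm{Hom}^t_{\mathcal A}(N\otimes_{\mathbb F_2}F_i,\mathbb F_2)$, where $\mathcal A$ acts diagonally through the Cartan formula and $\mathrm{Hom}^t$ denotes the maps that vanish outside internal degree $t$. For each $t$ this is a cochain complex in $i$. *Curtis tables.* Let $X_0\to X_1\to\cdots$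 be a complex of $\mathbb F_2$-vector spaces with ordered bases $\{x_{i,j}\}_j$. The leading term of a nonzero vector is the largest basis element occurring in it. A Curtis table consists of lists $L_i$ of items, each item of $L_i$ being a basis element $x_{i,j}$ (an untagged item) or a tag $x_{i,j}\leftarrow x_{i-1,k}$, such that (1) each basis element appears exactly once in the lists; (2) $x_{i,j}$ occurs in $L_i$ as an untagged item or as the left entry of a tag if and only if it is the leading term of a cocycle of $X_i$; (3) for each tag $a\leftarrow b$ in $L_i$ there is a vector of $X_{i-1}$ with leading term $b$ whose coboundary has leading term $a$. **Theorem.** Fix $m$, $n$ and $t$. 1. $C^{i,t}(M)$ and $C^{i,t}(M_m^n)$ have bases $\{e_k\otimes r_{i,j}\}$ dual to the elements $e_k^*\otimes r_{i,j}^*$ of degree $t$ (with $m\le\dim k\le n$ in the second case). With respect to these bases in lexicographic order, each of the complexes $C^{*,t}(M)$ and $C^{*,t}(M_m^n)$ has exactly one Curtis table; call these the tables of $X$ and of $X_m^n$. 2. The tags of the table of $X_m^n$ are exactly the tags $a\leftarrow b$ of the table of $X$ for which both $a$ and $b$ come from cells of dimensions $m$ through $n$ (the surviving tags). 3. The untagged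 items of the table of $X_m^n$ are exactly the elements $e_k\otimes r_{i,j}$ with $m\le\dim k\le n$ that appear in no surviving tag. They include all untagged items of the table of $X$ in this range, and possibly further ones. 4. Consequently the Adams $E_2$-page of $X_m^n$ can be read off from the table of $X$. Let $U^{s,t}$ be the set of elements $e_k\otimes r_{s,j}$ of internal degree $t$ with $m\le\dim k\le n$ that appear in no surviving tag. If for every $x\in U^{s,t}$ a cocycle $z_x\in C^{s,t}(M_m^n)$ with leading term $x$ is chosen, then the classes of the $z_x$ form a basis of $H^s(C^{*,t}(M_m^n))$. Moreover $E_2^{s,t}=\mathrm{Ext}^{s,t}_{\mathcal A}(M_m^n,\mathbb F_2)$, computed from any graded free resolution of $M_m^n$, is isomorphic to the $\mathbb F_2$-vector space with basis $U^{s,t}$. -/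

import Mathlib

open scoped TensorProduct DirectSum
open Module

noncomputable section

/-! ### The mod 2 Steenrod algebra -/

/-- Relations of the mod 2 Steenrod algebra on the generators `Sq^0, Sq^1, …`:
`Sq^0 = 1` and the Adem relations. In the latter `c ≤ a / 2 < b`, so that no subtraction truncates. -/
inductive AdemRel : FreeAlgebra (ZMod 2) ℕ → FreeAlgebra (ZMod 2) ℕ → Prop
  | sq_zero : AdemRel (FreeAlgebra.ι (ZMod 2) 0) 1
  | adem (a b : ℕ) (ha : 0 < a) (hab : a < 2 * b) :
      AdemRel (FreeAlgebra.ι (ZMod 2) a * FreeAlgebra.ι (ZMod 2) b)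
        (∑ c ∈ Finset.range (a / 2 + 1), (((b - c - 1).choose (a - 2 * c) : ℕ) : ZMod 2) •
          (FreeAlgebra.ι (ZMod 2) (a + b - c) * FreeAlgebra.ι (ZMod 2) c))

/-- The mod 2 Steenrod algebra `𝒜`. -/
def SteenrodAlgebra : Type := RingQuot AdemRel

namespace SteenrodAlgebra

instance : Ring SteenrodAlgebra := inferInstanceAs (Ring (RingQuot AdemRel))

instance : Algebra (ZMod 2) SteenrodAlgebra :=
  inferInstanceAs (Algebra (ZMod 2) (RingQuot AdemRel))

/-- The quotient map from the free algebra. -/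
def mk : FreeAlgebra (ZMod 2) ℕ →ₐ[ZMod 2] SteenrodAlgebra :=
  RingQuot.mkAlgHom (ZMod 2) AdemRel

/-- The Steenrod square `Sq^n`. -/
def Sq (n : ℕ) : SteenrodAlgebra := mk (FreeAlgebra.ι (ZMod 2) n)

theorem mk_surjective : Function.Surjective mk :=
  RingQuot.mkAlgHom_surjective (ZMod 2) AdemRel

/-- The augmentation `𝒜 → 𝔽₂`: `Sq^0 ↦ 1` and `Sq^n ↦ 0` for `n > 0`. -/
def augmentation : SteenrodAlgebra →ₐ[ZMod 2] ZMod 2 :=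
  RingQuot.liftAlgHom (ZMod 2)
    ⟨FreeAlgebra.lift (ZMod 2) (fun n : ℕ => if n = 0 then (1 : ZMod 2) else 0), by
      intro x y h
      cases h with
      | sq_zero => simp
      | adem a b ha hab =>
        have ha' : a ≠ 0 := ha.ne'
        simp only [map_mul, map_sum, map_smul, FreeAlgebra.lift_ι_apply, if_neg ha', zero_mul]
        symm
        apply Finset.sum_eq_zero
        intro c hc
        have hc' : c ≤ a / 2 := by simpa [Nat.lt_succ_iff] using hc
        have h0 : a + b - c ≠ 0 := by omega
        rw [if_neg h0, zero_mul, smul_zero]⟩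

/-- `𝔽₂` as the trivial `𝒜`-module. -/
instance : Module SteenrodAlgebra (ZMod 2) :=
  Module.compHom (ZMod 2) augmentation.toRingHom

theorem smul_zmod (a : SteenrodAlgebra) (x : ZMod 2) : a • x = augmentation a * x := rfl

instance : IsScalarTower (ZMod 2) SteenrodAlgebra (ZMod 2) where
  smul_assoc c a x := by
    simp only [smul_zmod, map_smul, smul_eq_mul, mul_assoc]

end SteenrodAlgebra

open SteenrodAlgebra (Sq)

/-- Prefer the inherited scalar multiplication on a subspace to the one that every abelian group
of exponent `2` carries (the two agree). -/
instance (priority := 2000) submoduleModuleZMod {V : Type*} [AddCommGroup V] [Module (ZMod 2) V]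
    (S : Submodule (ZMod 2) V) : Module (ZMod 2) S := S.module

/-- The same for an `𝒜`-submodule. -/
instance (priority := 2000) steenrodSubmoduleModuleZMod {V : Type*} [AddCommGroup V]
    [Module (ZMod 2) V] [Module SteenrodAlgebra V] [IsScalarTower (ZMod 2) SteenrodAlgebra V]
    (S : Submodule SteenrodAlgebra V) : Module (ZMod 2) S := S.module'

/-! ### Graded modules and truncations -/

section Graded

variable {M : Type*} [AddCommGroup M] [Module (ZMod 2) M] [Module SteenrodAlgebra M]

/-- The subspaces `𝓜 p`, `p ∈ ℤ`, make `M` a graded `𝒜`-module, with `Sq^i` of degree `i`. -/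
structure IsGradedSteenrodModule (𝓜 : ℤ → Submodule (ZMod 2) M) : Prop where
  isInternal : DirectSum.IsInternal 𝓜
  sq_smul_mem : ∀ (i : ℕ) (p : ℤ) (x : M), x ∈ 𝓜 p → Sq i • x ∈ 𝓜 (p + i)

/-- `M^{≥ m}`: the `𝒜`-submodule generated by the homogeneous elements of degree at least `m`.
As a vector space it is the sum of the `𝓜 p` with `m ≤ p`, see `degreeGE_eq_iSup`. -/
def degreeGE (𝓜 : ℤ → Submodule (ZMod 2) M) (m : ℤ) : Submodule SteenrodAlgebra M :=
  Submodule.span SteenrodAlgebra {x | ∃ p : ℤ, m ≤ p ∧ x ∈ 𝓜 p}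

theorem mem_degreeGE (𝓜 : ℤ → Submodule (ZMod 2) M) {m p : ℤ} (h : m ≤ p) {x : M}
    (hx : x ∈ 𝓜 p) : x ∈ degreeGE 𝓜 m :=
  Submodule.subset_span ⟨p, h, hx⟩

variable [IsScalarTower (ZMod 2) SteenrodAlgebra M]

theorem degreeGE_eq_iSup {𝓜 : ℤ → Submodule (ZMod 2) M} (h : IsGradedSteenrodModule 𝓜) (m : ℤ) :
    (degreeGE 𝓜 m).restrictScalars (ZMod 2) = ⨆ p : Set.Ici m, 𝓜 p := by
  apply le_antisymm
  · have key : ∀ (y : FreeAlgebra (ZMod 2) ℕ) (x : M), x ∈ (⨆ p : Set.Ici m, 𝓜 p) →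
        SteenrodAlgebra.mk y • x ∈ (⨆ p : Set.Ici m, 𝓜 p) := by
      intro y
      induction y using FreeAlgebra.induction with
      | grade0 r =>
        intro x hx
        rw [AlgHom.commutes, algebraMap_smul]
        exact Submodule.smul_mem _ _ hx
      | grade1 n =>
        intro x hx
        induction hx using Submodule.iSup_induction' with
        | mem p x hx =>
          have hp : m ≤ (p : ℤ) := p.2
          exact Submodule.mem_iSup_of_mem (⟨p + n, by simp only [Set.mem_Ici]; omega⟩ : Set.Ici m)
            (h.sq_smul_mem n p x hx)
        | zero => rw [smul_zero]; exact Submodule.zero_mem _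
        | add x y _ _ hx hy => rw [smul_add]; exact Submodule.add_mem _ hx hy
      | mul a b ha hb =>
        intro x hx
        rw [map_mul, mul_smul]
        exact ha _ (hb _ hx)
      | add a b ha hb =>
        intro x hx
        rw [map_add, add_smul]
        exact Submodule.add_mem _ (ha _ hx) (hb _ hx)
    intro x hx
    rw [Submodule.restrictScalars_mem] at hx
    induction hx using Submodule.span_induction with
    | mem x hx =>
      obtain ⟨p, hp, hx⟩ := hx
      exact Submodule.mem_iSup_of_mem (⟨p, hp⟩ : Set.Ici m) hx
    | zero => exact Submodule.zero_mem _
    | add x y _ _ hx hy => exact Submodule.add_mem _ hx hy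
    | smul a x _ hx =>
      obtain ⟨y, rfl⟩ := SteenrodAlgebra.mk_surjective a
      exact key y x hx
  · exact iSup_le fun p x hx => mem_degreeGE 𝓜 p.2 hx

/-- The truncation `M_m^n = M^{≥ m} / M^{≥ n + 1}` of a graded `𝒜`-module to the degrees `m, …, n`:
for `M = H^*(X)` this is the cohomology of the truncation `X_m^n`. -/
abbrev Truncation (𝓜 : ℤ → Submodule (ZMod 2) M) (m n : ℤ) : Type _ :=
  ↥(degreeGE 𝓜 m) ⧸ (degreeGE 𝓜 (n + 1)).submoduleOf (degreeGE 𝓜 m)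

/-- The grading of the truncation. -/
def truncationGrading (𝓜 : ℤ → Submodule (ZMod 2) M) (m n : ℤ) :
    ℤ → Submodule (ZMod 2) (Truncation 𝓜 m n) := fun p =>
  ((𝓜 p).comap ((degreeGE 𝓜 m).subtype.restrictScalars (ZMod 2))).map
    (((degreeGE 𝓜 (n + 1)).submoduleOf (degreeGE 𝓜 m)).mkQ.restrictScalars (ZMod 2))

/-- The cells in dimensions `m` through `n`. -/
abbrev CellsBetween {κ : Type*} (dim : κ → ℤ) (m n : ℤ) : Type _ :=
  {k : κ // m ≤ dim k ∧ dim k ≤ n}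

/-- The classes in the truncation of those given homogeneous elements `e k` of `M` whose degree
lies between `m` and `n`. -/
def truncationVec {κ : Type*} (𝓜 : ℤ → Submodule (ZMod 2) M) (e : κ → M) (dim : κ → ℤ)
    (he : ∀ k, e k ∈ 𝓜 (dim k)) (m n : ℤ) (k : CellsBetween dim m n) : Truncation 𝓜 m n :=
  Submodule.Quotient.mk ⟨e k, mem_degreeGE 𝓜 k.2.1 (he k)⟩

/-- `𝔽₂` concentrated in degree `0`. -/
def trivialGrading : ℤ → Submodule (ZMod 2) (ZMod 2) := fun p => if p = 0 then ⊤ else ⊥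

end Graded

/-! ### Graded free resolutions, and Ext -/

universe v w

/-- A resolution `⋯ → F_1 → F_0 → N → 0` of a graded `𝒜`-module by graded free `𝒜`-modules, with
a chosen homogeneous `𝒜`-basis of each `F_i`. -/
structure GradedFreeResolution {N : Type*} [AddCommGroup N] [Module (ZMod 2) N]
    [Module SteenrodAlgebra N] (𝓝 : ℤ → Submodule (ZMod 2) N) where
  obj : ℕ → Type v
  [addCommGroup : ∀ i, AddCommGroup (obj i)]
  [moduleZMod : ∀ i, Module (ZMod 2) (obj i)]
  [module : ∀ i, Module SteenrodAlgebra (obj i)]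
  [isScalarTower : ∀ i, IsScalarTower (ZMod 2) SteenrodAlgebra (obj i)]
  grading : ∀ i, ℤ → Submodule (ZMod 2) (obj i)
  isGraded : ∀ i, IsGradedSteenrodModule (grading i)
  idx : ℕ → Type w
  gen : ∀ i, Basis (idx i) SteenrodAlgebra (obj i)
  deg : ∀ i, idx i → ℤ
  gen_mem : ∀ i j, gen i j ∈ grading i (deg i j)
  d : ∀ i, obj (i + 1) →ₗ[SteenrodAlgebra] obj i
  aug : obj 0 →ₗ[SteenrodAlgebra] N
  d_mem : ∀ i p x, x ∈ grading (i + 1) p → d i x ∈ grading i p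
  aug_mem : ∀ p x, x ∈ grading 0 p → aug x ∈ 𝓝 p
  exact : ∀ i, Function.Exact (d (i + 1)) (d i)
  exact_zero : Function.Exact (d 0) aug
  aug_surjective : Function.Surjective aug

attribute [instance] GradedFreeResolution.addCommGroup GradedFreeResolution.moduleZMod
  GradedFreeResolution.module GradedFreeResolution.isScalarTower

section Cohomology

variable {X : ℕ → Type*} [∀ i, AddCommGroup (X i)] [∀ i, Module (ZMod 2) (X i)]

/-- The coboundaries in a cochain complex `X 0 → X 1 → ⋯`. -/
def coboundaries (δ : ∀ i, X i →ₗ[ZMod 2] X (i + 1)) : ∀ i, Submodule (ZMod 2) (X i)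
  | 0 => ⊥
  | i + 1 => LinearMap.range (δ i)

/-- The cocycles in a cochain complex `X 0 → X 1 → ⋯`. -/
abbrev cocycles (δ : ∀ i, X i →ₗ[ZMod 2] X (i + 1)) (i : ℕ) : Submodule (ZMod 2) (X i) :=
  LinearMap.ker (δ i)

/-- The cohomology of a cochain complex `X 0 → X 1 → ⋯`. -/
abbrev Cohomology (δ : ∀ i, X i →ₗ[ZMod 2] X (i + 1)) (s : ℕ) : Type _ :=
  ↥(cocycles δ s) ⧸ (coboundaries δ s).submoduleOf (cocycles δ s)

/-- The cohomology class of a cocycle. -/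
def cohomologyClass (δ : ∀ i, X i →ₗ[ZMod 2] X (i + 1)) (s : ℕ) :
    cocycles δ s →ₗ[ZMod 2] Cohomology δ s :=
  ((coboundaries δ s).submoduleOf (cocycles δ s)).mkQ

end Cohomology

section Ext

variable {N : Type*} [AddCommGroup N] [Module (ZMod 2) N] [Module SteenrodAlgebra N]
  {𝓝 : ℤ → Submodule (ZMod 2) N}

/-- `Hom_𝒜^t(P_i, 𝔽₂)`: the `𝒜`-linear maps `P_i → 𝔽₂` that vanish outside degree `t`. -/
def resolutionHom (P : GradedFreeResolution.{v, w} 𝓝) (t : ℤ) (i : ℕ) :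
    Submodule (ZMod 2) (Dual (ZMod 2) (P.obj i)) where
  carrier := {f | (∀ (a : SteenrodAlgebra) (x : P.obj i), f (a • x) = a • f x) ∧
    ∀ p : ℤ, p ≠ t → ∀ x ∈ P.grading i p, f x = 0}
  add_mem' := by
    rintro f g ⟨hf, hf'⟩ ⟨hg, hg'⟩
    refine ⟨fun a x => by simp [hf, hg], fun p hp x hx => by simp [hf' p hp x hx, hg' p hp x hx]⟩
  zero_mem' := by simp
  smul_mem' := by
    rintro c f ⟨hf, hf'⟩
    refine ⟨fun a x => ?_, fun p hp x hx => by simp [hf' p hp x hx]⟩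
    simp only [LinearMap.smul_apply, hf, SteenrodAlgebra.smul_zmod, smul_eq_mul]
    ring

/-- The differential of `Hom_𝒜^t(P_*, 𝔽₂)`. -/
def resolutionHomD (P : GradedFreeResolution.{v, w} 𝓝) (t : ℤ) (i : ℕ) :
    resolutionHom P t i →ₗ[ZMod 2] resolutionHom P t (i + 1) :=
  ((LinearMap.lcomp (ZMod 2) (ZMod 2) ((P.d i).restrictScalars (ZMod 2))).domRestrict
    (resolutionHom P t i)).codRestrict (resolutionHom P t (i + 1)) (by
      rintro ⟨f, hf, hf'⟩
      refine ⟨fun a x => ?_, fun p hp x hx => ?_⟩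
      · simp [hf]
      · simpa using hf' p hp _ (P.d_mem i p x hx))

/-- `Ext_𝒜^{s,t}(N, 𝔽₂)`, computed from the graded free resolution `P` of `N`. -/
abbrev SteenrodExt (P : GradedFreeResolution.{v, w} 𝓝) (s : ℕ) (t : ℤ) : Type _ :=
  Cohomology (X := fun i => ↥(resolutionHom P t i)) (resolutionHomD P t) s

end Ext

/-! ### The complex `Hom_𝒜(M ⊗ F_*, 𝔽₂)` -/

section Diagonal

variable {M : Type*} [AddCommGroup M] [Module (ZMod 2) M] [Module SteenrodAlgebra M]
  [IsScalarTower (ZMod 2) SteenrodAlgebra M]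

/-- The diagonal action of `Sq^n` on `M ⊗ N`, by the Cartan formula
`Sq^n (x ⊗ y) = ∑_{i + j = n} Sq^i x ⊗ Sq^j y`. -/
def cartanSq (M N : Type*) [AddCommGroup M] [Module (ZMod 2) M] [Module SteenrodAlgebra M]
    [IsScalarTower (ZMod 2) SteenrodAlgebra M] [AddCommGroup N] [Module (ZMod 2) N]
    [Module SteenrodAlgebra N] [IsScalarTower (ZMod 2) SteenrodAlgebra N] (n : ℕ) :
    M ⊗[ZMod 2] N →ₗ[ZMod 2] M ⊗[ZMod 2] N :=
  ∑ p ∈ Finset.HasAntidiagonal.antidiagonal n,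
    TensorProduct.map (Algebra.lsmul (ZMod 2) (ZMod 2) M (Sq p.1))
      (Algebra.lsmul (ZMod 2) (ZMod 2) N (Sq p.2))

variable {L : Type*} [AddCommGroup L] [Module (ZMod 2) L] [Module SteenrodAlgebra L]
  {𝓛 : ℤ → Submodule (ZMod 2) L}

/-- `Hom_𝒜^t(M ⊗ F_i, 𝔽₂)` for the diagonal action on `M ⊗ F_i`: the linear maps that commute with
all Steenrod squares (which generate `𝒜`) and vanish outside degree `t`. -/
def diagonalHom (𝓜 : ℤ → Submodule (ZMod 2) M) (F : GradedFreeResolution.{v, w} 𝓛) (t : ℤ)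
    (i : ℕ) : Submodule (ZMod 2) (Dual (ZMod 2) (M ⊗[ZMod 2] F.obj i)) where
  carrier := {f | (∀ (n : ℕ) (z : M ⊗[ZMod 2] F.obj i),
      f (cartanSq M (F.obj i) n z) = Sq n • f z) ∧
    ∀ p q : ℤ, p + q ≠ t → ∀ x ∈ 𝓜 p, ∀ y ∈ F.grading i q, f (x ⊗ₜ[ZMod 2] y) = 0}
  add_mem' := by
    rintro f g ⟨hf, hf'⟩ ⟨hg, hg'⟩
    refine ⟨fun a x => by simp [hf, hg], fun p q hp x hx y hy => by
      simp [hf' p q hp x hx y hy, hg' p q hp x hx y hy]⟩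
  zero_mem' := by simp
  smul_mem' := by
    rintro c f ⟨hf, hf'⟩
    refine ⟨fun a x => ?_, fun p q hp x hx y hy => by simp [hf' p q hp x hx y hy]⟩
    simp only [LinearMap.smul_apply, hf, SteenrodAlgebra.smul_zmod, smul_eq_mul]
    ring

theorem cartanSq_lTensor (F : GradedFreeResolution.{v, w} 𝓛) (i n : ℕ)
    (z : M ⊗[ZMod 2] F.obj (i + 1)) :
    LinearMap.lTensor M ((F.d i).restrictScalars (ZMod 2)) (cartanSq M (F.obj (i + 1)) n z) =
      cartanSq M (F.obj i) n (LinearMap.lTensor M ((F.d i).restrictScalars (ZMod 2)) z) := by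
  induction z using TensorProduct.induction_on with
  | zero => simp
  | tmul x y => simp [cartanSq, LinearMap.sum_apply]
  | add x y hx hy => simp only [map_add, hx, hy]

/-- The differential `f ↦ f ∘ (1 ⊗ d)` of `Hom_𝒜^t(M ⊗ F_*, 𝔽₂)`. -/
def diagonalHomD (𝓜 : ℤ → Submodule (ZMod 2) M) (F : GradedFreeResolution.{v, w} 𝓛) (t : ℤ)
    (i : ℕ) : diagonalHom 𝓜 F t i →ₗ[ZMod 2] diagonalHom 𝓜 F t (i + 1) :=
  ((LinearMap.lcomp (ZMod 2) (ZMod 2)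
    (LinearMap.lTensor M ((F.d i).restrictScalars (ZMod 2)))).domRestrict
    (diagonalHom 𝓜 F t i)).codRestrict (diagonalHom 𝓜 F t (i + 1)) (by
      rintro ⟨f, hf, hf'⟩
      refine ⟨fun n z => ?_, fun p q hp x hx y hy => ?_⟩
      · simp only [LinearMap.domRestrict_apply, LinearMap.lcomp_apply, cartanSq_lTensor, hf]
      · simpa using hf' p q hp x hx _ (F.d_mem i q y hy))

/-- The cocycles in degree `s` of `Hom_𝒜^t(M ⊗ F_*, 𝔽₂)`. -/
abbrev DiagonalCocycles (𝓜 : ℤ → Submodule (ZMod 2) M) (F : GradedFreeResolution.{v, w} 𝓛)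
    (t : ℤ) (s : ℕ) : Type _ :=
  ↥(cocycles (X := fun i => ↥(diagonalHom 𝓜 F t i)) (diagonalHomD 𝓜 F t) s)

/-- The cohomology in degree `s` of `Hom_𝒜^t(M ⊗ F_*, 𝔽₂)`. -/
abbrev DiagonalCohomology (𝓜 : ℤ → Submodule (ZMod 2) M) (F : GradedFreeResolution.{v, w} 𝓛)
    (t : ℤ) (s : ℕ) : Type _ :=
  Cohomology (X := fun i => ↥(diagonalHom 𝓜 F t i)) (diagonalHomD 𝓜 F t) s

/-- The index set of the basis elements `e_k ⊗ r_{i,j}` of internal degree `t`, with the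
lexicographic order. -/
abbrev TensorIndex {κ : Type*} (dim : κ → ℤ) (F : GradedFreeResolution.{v, w} 𝓛) (t : ℤ)
    (i : ℕ) : Type _ :=
  {p : κ ×ₗ F.idx i // dim (ofLex p).1 + F.deg i (ofLex p).2 = t}

/-- `B i` consists of the elements `e_k ⊗ r_{i,j}` of `Hom_𝒜^t(M ⊗ F_i, 𝔽₂)` dual to the
`e k ⊗ F.gen i j`. -/
def IsDualBasis {κ : Type*} {𝓜 : ℤ → Submodule (ZMod 2) M} (e : κ → M) (dim : κ → ℤ)
    {F : GradedFreeResolution.{v, w} 𝓛} {t : ℤ}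
    (B : ∀ i, Basis (TensorIndex dim F t i) (ZMod 2) (diagonalHom 𝓜 F t i)) : Prop :=
  ∀ (i : ℕ) (x : TensorIndex dim F t i) (k : κ) (j : F.idx i),
    (x.1 = toLex (k, j) → (B i x).1 (e k ⊗ₜ[ZMod 2] F.gen i j) = 1) ∧
    (x.1 ≠ toLex (k, j) → (B i x).1 (e k ⊗ₜ[ZMod 2] F.gen i j) = 0)

/-- A basis element `e_k ⊗ r_{i,j}` with `m ≤ dim k ≤ n` as a basis element for all cells. -/
def TensorIndex.incl {κ : Type*} {dim : κ → ℤ} {F : GradedFreeResolution.{v, w} 𝓛} {t m n : ℤ}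
    {i : ℕ} (x : TensorIndex (fun k : CellsBetween dim m n => dim k) F t i) :
    TensorIndex dim F t i :=
  ⟨toLex ((ofLex x.1).1.1, (ofLex x.1).2), x.2⟩

end Diagonal

/-! ### Curtis tables -/

/-- The items that may occur on the `i`-th list `L_i` of a Curtis table: an element `x ∈ ι i`, or a
tag `a ← b` with `a ∈ ι i` and `b ∈ ι (i - 1)`. -/
inductive CurtisItem (ι : ℕ → Type*) : ℕ → Type _
  | single {i : ℕ} (x : ι i) : CurtisItem ι i
  | tag {i : ℕ} (a : ι (i + 1)) (b : ι i) : CurtisItem ι (i + 1)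

/-- The element `y` appears in the given item. -/
def CurtisItem.Mentions {ι : ℕ → Type*} : {i : ℕ} → CurtisItem ι i → (Σ j, ι j) → Prop
  | i, .single x, y => y = ⟨i, x⟩
  | _, .tag (i := i) a b, y => y = ⟨i + 1, a⟩ ∨ y = ⟨i, b⟩

/-- `j` indexes the leading term of `v`: the largest basis element occurring in `v`. -/
def IsLeadingTerm {ι V : Type*} [LinearOrder ι] [AddCommGroup V] [Module (ZMod 2) V]
    (b : Basis ι (ZMod 2) V) (v : V) (j : ι) : Prop :=
  b.repr v j ≠ 0 ∧ ∀ k, b.repr v k ≠ 0 → k ≤ j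

/-- The lists `L i` (as sets of items, since the order within a list carries no information) form a
Curtis table of the complex `X 0 → X 1 → ⋯` with respect to the ordered bases `B i`. -/
structure IsCurtisTable {ι : ℕ → Type*} [∀ i, LinearOrder (ι i)] {X : ℕ → Type*}
    [∀ i, AddCommGroup (X i)] [∀ i, Module (ZMod 2) (X i)]
    (δ : ∀ i, X i →ₗ[ZMod 2] X (i + 1)) (B : ∀ i, Basis (ι i) (ZMod 2) (X i))
    (L : ∀ i, Set (CurtisItem ι i)) : Prop where
  appears_once : ∀ y : Σ i, ι i,
    ∃! q : Σ i, CurtisItem ι i, q.2 ∈ L q.1 ∧ q.2.Mentions y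
  single_or_head_iff_zero : ∀ x : ι 0, CurtisItem.single x ∈ L 0 ↔
    ∃ v : X 0, δ 0 v = 0 ∧ IsLeadingTerm (B 0) v x
  single_or_head_iff_succ : ∀ (i : ℕ) (x : ι (i + 1)),
    (CurtisItem.single x ∈ L (i + 1) ∨ ∃ b : ι i, CurtisItem.tag x b ∈ L (i + 1)) ↔
      ∃ v : X (i + 1), δ (i + 1) v = 0 ∧ IsLeadingTerm (B (i + 1)) v x
  tag_boundary : ∀ (i : ℕ) (a : ι (i + 1)) (b : ι i), CurtisItem.tag a b ∈ L (i + 1) →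
    ∃ v : X i, IsLeadingTerm (B i) v b ∧ IsLeadingTerm (B (i + 1)) (δ i v) a

/-- Curtis tables of `Hom_𝒜^t(M ⊗ F_*, 𝔽₂)` with respect to ordered bases indexed by the
`e_k ⊗ r_{i,j}`. -/
abbrev IsDiagonalCurtisTable {M : Type*} [AddCommGroup M] [Module (ZMod 2) M]
    [Module SteenrodAlgebra M] [IsScalarTower (ZMod 2) SteenrodAlgebra M]
    {L : Type*} [AddCommGroup L] [Module (ZMod 2) L] [Module SteenrodAlgebra L]
    {𝓛 : ℤ → Submodule (ZMod 2) L} {𝓜 : ℤ → Submodule (ZMod 2) M} {κ : Type*} [LinearOrder κ]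
    {dim : κ → ℤ} {F : GradedFreeResolution.{v, w} 𝓛} [∀ i, LinearOrder (F.idx i)] {t : ℤ}
    (B : ∀ i, Basis (TensorIndex dim F t i) (ZMod 2) (diagonalHom 𝓜 F t i))
    (T : ∀ i, Set (CurtisItem (TensorIndex dim F t) i)) : Prop :=
  IsCurtisTable (X := fun i => ↥(diagonalHom 𝓜 F t i)) (diagonalHomD 𝓜 F t) B T

/-- `x` appears in no surviving tag of the table `T`, that is, in no tag `a ← b` of `T` both of
whose entries come from cells in dimensions `m` through `n`. -/
def NotInSurvivingTag {L : Type*} [AddCommGroup L] [Module (ZMod 2) L] [Module SteenrodAlgebra L]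
    {𝓛 : ℤ → Submodule (ZMod 2) L} {κ : Type*} {dim : κ → ℤ}
    {F : GradedFreeResolution.{v, w} 𝓛} {t m n : ℤ}
    (T : ∀ i, Set (CurtisItem (TensorIndex dim F t) i)) {s : ℕ}
    (x : TensorIndex (fun k : CellsBetween dim m n => dim k) F t s) : Prop :=
  ¬ ∃ (i : ℕ) (a : TensorIndex (fun k : CellsBetween dim m n => dim k) F t (i + 1))
      (b : TensorIndex (fun k : CellsBetween dim m n => dim k) F t i),
    CurtisItem.tag a.incl b.incl ∈ T (i + 1) ∧
      CurtisItem.Mentions (ι := TensorIndex (fun k : CellsBetween dim m n => dim k) F t)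
        (CurtisItem.tag a b) ⟨s, x⟩

end

/-!
A Curtis table depends only on leading terms: its tags are the pairs `a ← b` for which `b` is the
least leading term of the vectors whose coboundary is led by `a`, and its untagged items are the
leading terms of cocycles that do not lead a coboundary. In the lexicographic order the cell comes
first, and the `e_k` are ordered by degree. Hence `C^{*,t}(M)` and `C^{*,t}(M_m^n)` are compared by
forgetting coordinates outside a segment of the ordered basis: a cochain of `M` restricts to one of
the submodule `M^{≥ m}`, where the cochains of the quotient `M_m^n` are those that vanish on the
cells above `n`. A tag `a ← b` with both ends in the segment does not see the forgotten coordinates,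
as the smaller ones do not affect leading terms and the larger ones vanish.

That the Cartan formula defines an action of `𝒜` on `N ⊗ F` follows from the form of the Adem
relations due to Bullett and Macdonald, which is multiplicative. For a basis `e_k` of `N` ordered by
degree and an `𝒜`-basis `r_j` of `F`, the Cartan formula for `a (e_k ⊗ r_j)` begins with
`e_k ⊗ a r_j`, and the other terms lie over later cells; so the `e_k ⊗ r_j` are an `𝒜`-basis of
`N ⊗ F`. Thus `N ⊗ F_*` is a free resolution of `N`, the cochains have the dual basis, and
the comparison of resolutions identifies their cohomology with `Ext`.
-/

noncomputable section

universe v w v' w'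

open SteenrodAlgebra (Sq)

/-! ### Bullett–Macdonald relations -/

section BullettMacdonald

open Polynomial Finset

/-- The residue of `g / (s (1 + s)) ^ (a + 1)` at `s = 0`. As `d(s (1 + s)) = ds` modulo `2`, it
extracts the coefficient of `u ^ a` from a polynomial in `u = s (1 + s)`. -/
def residue (a : ℕ) : (ZMod 2)[X] →ₗ[ZMod 2] ZMod 2 :=
  PowerSeries.coeff a ∘ₗ
    LinearMap.mulRight (ZMod 2) ((PowerSeries.invOneSubPow (ZMod 2) (a + 1)).val) ∘ₗ
      (Polynomial.coeToPowerSeries.algHom (ZMod 2)).toLinearMap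

theorem residue_apply (a : ℕ) (g : (ZMod 2)[X]) : residue a g =
    PowerSeries.coeff a ((g : PowerSeries (ZMod 2)) *
      (PowerSeries.invOneSubPow (ZMod 2) (a + 1)).val) := by
  simp [residue, Polynomial.coeToPowerSeries.algHom_apply]

theorem one_add_X_pow_mul_invOneSubPow (d e : ℕ) :
    (1 + PowerSeries.X) ^ e * (PowerSeries.invOneSubPow (ZMod 2) (e + d)).val =
      (PowerSeries.invOneSubPow (ZMod 2) d).val := by
  have h : (1 + PowerSeries.X : PowerSeries (ZMod 2)) = 1 - PowerSeries.X := by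
    ext n
    rw [map_add, map_sub, CharTwo.sub_eq_add]
  rw [h, add_comm, PowerSeries.one_sub_pow_mul_invOneSubPow_val_add_eq_invOneSubPow_val]

theorem residue_X_pow_mul_of_lt {a k : ℕ} (h : a < k) (g : (ZMod 2)[X]) :
    residue a (X ^ k * g) = 0 := by
  rw [residue_apply]
  push_cast
  rw [mul_assoc, PowerSeries.coeff_X_pow_mul', if_neg (by omega)]

theorem residue_pow (a k : ℕ) : residue a ((X * (1 + X)) ^ k) = if k = a then 1 else 0 := by
  rcases lt_or_ge a k with h | h
  · rw [mul_pow, residue_X_pow_mul_of_lt h, if_neg (by omega)]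
  · obtain ⟨d, rfl⟩ := Nat.exists_eq_add_of_le h
    rw [residue_apply, mul_pow]
    push_cast
    rw [mul_assoc, PowerSeries.coeff_X_pow_mul', if_pos h, add_assoc,
      one_add_X_pow_mul_invOneSubPow, PowerSeries.invOneSubPow_val_succ_eq_mk_add_choose]
    simp only [add_tsub_cancel_left, PowerSeries.coeff_mk]
    rcases Nat.eq_zero_or_pos d with rfl | hd
    · simp
    · rw [if_neg (by omega), ← two_mul, ← Nat.centralBinom_eq_two_mul_choose,
        ZMod.natCast_eq_zero_iff]
      exact Nat.two_dvd_centralBinom_of_one_le hd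

theorem residue_one_add_X_pow_mul {a c d : ℕ} (hc : 2 * c ≤ a) :
    residue a ((1 + X) ^ (a + 1 + d) * (X ^ 2) ^ c) = (d.choose (a - 2 * c) : ℕ) := by
  have hinv : (1 + PowerSeries.X) ^ (a + 1) *
      (PowerSeries.invOneSubPow (ZMod 2) (a + 1)).val = 1 := by
    simpa [PowerSeries.invOneSubPow_zero] using one_add_X_pow_mul_invOneSubPow 0 (a + 1)
  have hcancel : (((1 + X) ^ (a + 1 + d) * (X ^ 2) ^ c : (ZMod 2)[X]) : PowerSeries (ZMod 2)) *
      (PowerSeries.invOneSubPow (ZMod 2) (a + 1)).val =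
      PowerSeries.X ^ (2 * c) * (((1 + X) ^ d : (ZMod 2)[X]) : PowerSeries (ZMod 2)) := by
    push_cast
    rw [pow_add, pow_mul]
    linear_combination ((1 + PowerSeries.X) ^ d * (PowerSeries.X ^ 2) ^ c) * hinv
  rw [residue_apply, hcancel, PowerSeries.coeff_X_pow_mul', if_pos hc, Polynomial.coeff_coe,
    Polynomial.coeff_one_add_X_pow]

variable {R S : Type*} [AddCommGroup R] [Module (ZMod 2) R] [AddCommGroup S] [Module (ZMod 2) S]

/-- The part of degree `n` of the Bullett–Macdonald relation
`P(s² + st) P(t²) = P(t² + st) P(s²)` with `t = 1`; here `m a b` stands for the coefficient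
of `x ^ a y ^ b` in `P(x) P(y)`. -/
def BullettMacdonald (n : ℕ) (m : ℕ → ℕ → R) : Prop :=
  ∑ p ∈ antidiagonal n, ((X * (1 + X)) ^ p.1 : (ZMod 2)[X]) ⊗ₜ[ZMod 2] m p.1 p.2 =
    ∑ p ∈ antidiagonal n, ((1 + X) ^ p.1 * (X ^ 2) ^ p.2 : (ZMod 2)[X]) ⊗ₜ[ZMod 2] m p.1 p.2

namespace BullettMacdonald

variable {n : ℕ} {m m' : ℕ → ℕ → R}

theorem map (h : BullettMacdonald n m) (f : R →ₗ[ZMod 2] S) :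
    BullettMacdonald n (fun a b => f (m a b)) := by
  have := congrArg (LinearMap.lTensor (ZMod 2)[X] f) h
  simp only [map_sum, LinearMap.lTensor_tmul] at this
  exact this

theorem zero : BullettMacdonald n (0 : ℕ → ℕ → R) := by
  simp [BullettMacdonald]

theorem add (h : BullettMacdonald n m) (h' : BullettMacdonald n m') :
    BullettMacdonald n (m + m') := by
  simp only [BullettMacdonald, Pi.add_apply, TensorProduct.tmul_add, Finset.sum_add_distrib]
  exact congrArg₂ (· + ·) h h'

theorem congr (h : BullettMacdonald n m) (hm : ∀ a b, a + b = n → m a b = m' a b) :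
    BullettMacdonald n m' := by
  have hm' : ∀ p ∈ antidiagonal n, m p.1 p.2 = m' p.1 p.2 :=
    fun p hp => hm p.1 p.2 (HasAntidiagonal.mem_antidiagonal.1 hp)
  refine (Finset.sum_congr rfl fun p hp => ?_).trans
    (Eq.trans h (Finset.sum_congr rfl fun p hp => ?_)) <;> rw [hm' p hp]

theorem sum_smul_eq (h : BullettMacdonald n m) (φ : (ZMod 2)[X] →ₗ[ZMod 2] ZMod 2) :
    ∑ p ∈ antidiagonal n, φ ((X * (1 + X)) ^ p.1) • m p.1 p.2 =
      ∑ p ∈ antidiagonal n, φ ((1 + X) ^ p.1 * (X ^ 2) ^ p.2) • m p.1 p.2 := by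
  simpa only [map_sum, LinearMap.comp_apply, LinearMap.rTensor_tmul, LinearEquiv.coe_coe,
    TensorProduct.lid_tmul] using
    congrArg ((TensorProduct.lid (ZMod 2) R).toLinearMap ∘ₗ LinearMap.rTensor R φ) h

theorem adem {a b : ℕ} (h : BullettMacdonald (a + b) m) (hab : a < 2 * b) :
    m a b = ∑ c ∈ range (a / 2 + 1),
      (((b - c - 1).choose (a - 2 * c) : ℕ) : ZMod 2) • m (a + b - c) c := by
  have hleft : ∑ p ∈ antidiagonal (a + b), residue a ((X * (1 + X)) ^ p.1) • m p.1 p.2 =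
      m a b := by
    rw [Finset.sum_eq_single_of_mem (a, b) (by simp), residue_pow, if_pos rfl, one_smul]
    rintro ⟨p, q⟩ hp hne
    rw [residue_pow, if_neg, zero_smul]
    rintro rfl
    simp_all
  have hterm : ∀ c ∈ range (a / 2 + 1), residue a ((1 + X) ^ (a + b - c) * (X ^ 2) ^ c) =
      (((b - c - 1).choose (a - 2 * c) : ℕ) : ZMod 2) := fun c hc => by
    rw [Finset.mem_range] at hc
    rw [show a + b - c = a + 1 + (b - c - 1) by omega, residue_one_add_X_pow_mul (by omega)]
  have hvanish : ∀ c ∉ range (a / 2 + 1),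
      residue a ((1 + X) ^ (a + b - c) * (X ^ 2) ^ c) = 0 := fun c hc => by
    rw [Finset.mem_range] at hc
    rw [mul_comm, ← pow_mul, residue_X_pow_mul_of_lt (by omega)]
  rw [← hleft, h.sum_smul_eq, ← Finset.Nat.sum_antidiagonal_swap]
  simp only [Prod.fst_swap, Prod.snd_swap]
  rw [Finset.Nat.sum_antidiagonal_eq_sum_range_succ
      (fun c i => residue a ((1 + X) ^ i * (X ^ 2) ^ c) • m i c)]
  symm
  refine Finset.sum_subset_zero_on_sdiff (fun c hc => ?_) (fun c hc => ?_) (fun c hc => ?_)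
  · rw [Finset.mem_range] at hc ⊢
    omega
  · rw [hvanish c (Finset.mem_sdiff.1 hc).2, zero_smul]
  · rw [hterm c hc]

end BullettMacdonald

theorem sum_antidiagonal_choose {K : Type*} [CommSemiring K] {n j : ℕ} (hj : 3 * j ≤ n)
    (f g : K) :
    ∑ p ∈ antidiagonal n,
        (if 2 * j ≤ p.1 then ((n - 3 * j).choose (p.1 - 2 * j) : K) else 0) * (f ^ p.1 * g ^ p.2) =
      f ^ (2 * j) * g ^ j * (f + g) ^ (n - 3 * j) := by
  rw [(Commute.all f g).add_pow', Finset.mul_sum]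
  symm
  refine Finset.sum_of_injOn (fun p => (p.1 + 2 * j, p.2 + j)) ?_ ?_ ?_ ?_
  · rintro ⟨p, q⟩ - ⟨p', q'⟩ - h
    simp only [Prod.mk.injEq] at h ⊢
    omega
  · rintro ⟨p, q⟩ h
    simp only [Finset.mem_coe, HasAntidiagonal.mem_antidiagonal] at h ⊢
    omega
  · rintro ⟨p, q⟩ h h'
    simp only [HasAntidiagonal.mem_antidiagonal, Set.mem_image, Finset.mem_coe, Prod.mk.injEq,
      Prod.exists, not_exists, not_and] at h h'
    split_ifs with hp
    · rw [Nat.choose_eq_zero_of_lt, Nat.cast_zero, zero_mul]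
      by_contra hlt
      exact h' (p - 2 * j) (q - j) (by omega) (by omega) (by omega)
    · rw [zero_mul]
  · rintro ⟨p, q⟩ -
    simp only [nsmul_eq_mul, le_add_iff_nonneg_left, zero_le, if_true, add_tsub_cancel_right]
    ring

-- At `(x, y) = (s (1 + s), 1)` and at `(x, y) = (1 + s, s ^ 2)` alike, `x ^ 2 * y` is
-- `s ^ 2 (1 + s) ^ 2` and `x + y` is `1 + s + s ^ 2`.
theorem bullettMacdonald_choose_smul {n j : ℕ} (hj : 3 * j ≤ n) (w : R) :
    BullettMacdonald n (fun a _ =>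
      (if 2 * j ≤ a then ((n - 3 * j).choose (a - 2 * j) : ZMod 2) else 0) • w) := by
  have hsum : ∀ f g : (ZMod 2)[X], ∑ p ∈ antidiagonal n, (f ^ p.1 * g ^ p.2) ⊗ₜ[ZMod 2]
      ((if 2 * j ≤ p.1 then ((n - 3 * j).choose (p.1 - 2 * j) : ZMod 2) else 0) • w) =
      (f ^ (2 * j) * g ^ j * (f + g) ^ (n - 3 * j)) ⊗ₜ[ZMod 2] w := by
    intro f g
    rw [← sum_antidiagonal_choose hj, TensorProduct.sum_tmul]
    refine Finset.sum_congr rfl fun p _ => ?_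
    rw [← TensorProduct.smul_tmul]
    split_ifs
    · rw [Algebra.smul_def, map_natCast]
    · simp
  have hleft := hsum (X * (1 + X)) 1
  simp only [one_pow, mul_one] at hleft
  rw [BullettMacdonald, hleft, hsum]
  congr 1
  rw [show X * (1 + X) + 1 = (1 + X + X ^ 2 : (ZMod 2)[X]) by ring, mul_pow, ← pow_mul]
  ring

theorem exists_bullettMacdonald_eq (n : ℕ) (y : ℕ → R) (k : ℕ) :
    ∃ m, BullettMacdonald n m ∧ ∀ c < k, 3 * c ≤ n → m (n - c) c = y c := by
  induction k with
  | zero => exact ⟨0, BullettMacdonald.zero, by simp⟩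
  | succ k ih =>
    obtain ⟨m, hm, hy⟩ := ih
    by_cases hk : 3 * k ≤ n
    · refine ⟨_, hm.add (bullettMacdonald_choose_smul hk (y k - m (n - k) k)), fun c hck hc => ?_⟩
      rcases Nat.lt_succ_iff_lt_or_eq.1 hck with hlt | rfl
      · rw [Pi.add_apply, Pi.add_apply, if_pos (by omega), hy c hlt hc,
          Nat.choose_eq_zero_of_lt (by omega), Nat.cast_zero, zero_smul, add_zero]
      · rw [Pi.add_apply, Pi.add_apply, if_pos (by omega),
          show n - c - 2 * c = n - 3 * c by omega, Nat.choose_self, Nat.cast_one, one_smul,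
          add_sub_cancel]
    · exact ⟨m, hm, fun c hck hc => hy c (by omega) hc⟩

-- A family that satisfies the Adem relations is determined by its admissible members
-- `m (n - c) c`, `3 c ≤ n`, and Bullett–Macdonald families take arbitrary admissible values.
theorem bullettMacdonald_of_adem {n : ℕ} {m : ℕ → ℕ → R}
    (h : ∀ a b, a + b = n → a < 2 * b → m a b = ∑ c ∈ range (a / 2 + 1),
      (((b - c - 1).choose (a - 2 * c) : ℕ) : ZMod 2) • m (a + b - c) c) :
    BullettMacdonald n m := by
  obtain ⟨m', hm', hadm⟩ := exists_bullettMacdonald_eq n (fun c => m (n - c) c) (n + 1)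
  refine hm'.congr fun a b hab => ?_
  rcases lt_or_ge a (2 * b) with hlt | hge
  · subst hab
    rw [hm'.adem hlt, h a b rfl hlt]
    refine Finset.sum_congr rfl fun c hc => ?_
    rw [Finset.mem_range] at hc
    rw [hadm c (by omega) (by omega)]
  · have := hadm b (by omega) (by omega)
    rwa [show n - b = a by omega] at this

end BullettMacdonald

section GeneratingSeries

open Polynomial Finset

variable {E : Type*} [Ring E] [Algebra (ZMod 2) E]

/-- The series `∑ fⁿ ⊗ qₙ zⁿ`, that is, `∑ qₙ (f z)ⁿ`. The formal variable `z` keeps track of the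
degree, so that identities between products of such series hold degree by degree. -/
def generatingSeries (f : (ZMod 2)[X]) (q : ℕ → E) : PowerSeries ((ZMod 2)[X] ⊗[ZMod 2] E) :=
  PowerSeries.mk fun n => (f ^ n) ⊗ₜ q n

theorem coeff_generatingSeries_mul (f g : (ZMod 2)[X]) (q r : ℕ → E) (n : ℕ) :
    PowerSeries.coeff n (generatingSeries f q * generatingSeries g r) =
      ∑ p ∈ antidiagonal n, (f ^ p.1 * g ^ p.2) ⊗ₜ (q p.1 * r p.2) := by
  simp [generatingSeries, PowerSeries.coeff_mul, Algebra.TensorProduct.tmul_mul_tmul]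

/-- The Cauchy product of two sequences, as for the coefficients of a product of power series. -/
def cauchyProduct (q r : ℕ → E) (n : ℕ) : E := ∑ p ∈ antidiagonal n, q p.1 * r p.2

theorem generatingSeries_cauchyProduct (f : (ZMod 2)[X]) (q r : ℕ → E) :
    generatingSeries f (cauchyProduct q r) = generatingSeries f q * generatingSeries f r := by
  ext n
  rw [coeff_generatingSeries_mul, generatingSeries, PowerSeries.coeff_mk, cauchyProduct,
    TensorProduct.tmul_sum]
  refine Finset.sum_congr rfl fun p hp => ?_
  rw [← pow_add, HasAntidiagonal.mem_antidiagonal.1 hp]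

theorem commute_generatingSeries (f g : (ZMod 2)[X]) {q r : ℕ → E}
    (h : ∀ i j, Commute (q i) (r j)) :
    Commute (generatingSeries f q) (generatingSeries g r) := by
  ext n
  rw [coeff_generatingSeries_mul, coeff_generatingSeries_mul, ← Finset.Nat.sum_antidiagonal_swap]
  refine Finset.sum_congr rfl fun p _ => ?_
  rw [Prod.fst_swap, Prod.snd_swap, mul_comm, (h _ _).eq]

/-- The Bullett–Macdonald relations, in all degrees, for the products of members of a sequence. -/
def IsBullettMacdonald (q : ℕ → E) : Prop := ∀ n, BullettMacdonald n fun a b => q a * q b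

theorem isBullettMacdonald_iff (q : ℕ → E) : IsBullettMacdonald q ↔
    generatingSeries (X * (1 + X)) q * generatingSeries 1 q =
      generatingSeries (1 + X) q * generatingSeries (X ^ 2) q := by
  rw [PowerSeries.ext_iff]
  simp only [coeff_generatingSeries_mul, one_pow, mul_one]
  rfl

theorem IsBullettMacdonald.cauchyProduct {q r : ℕ → E} (hq : IsBullettMacdonald q)
    (hr : IsBullettMacdonald r) (h : ∀ i j, Commute (q i) (r j)) :
    IsBullettMacdonald (cauchyProduct q r) := by
  rw [isBullettMacdonald_iff] at *
  simp only [generatingSeries_cauchyProduct]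
  rw [((commute_generatingSeries 1 _ h).symm.mul_mul_mul_comm _ _),
    ((commute_generatingSeries (X ^ 2) _ h).symm.mul_mul_mul_comm _ _), hq, hr]

end GeneratingSeries

namespace SteenrodAlgebra

theorem Sq_zero : Sq 0 = 1 := by
  have := RingQuot.mkAlgHom_rel (ZMod 2) AdemRel.sq_zero
  rwa [map_one] at this

@[elab_as_elim]
theorem induction_on {p : SteenrodAlgebra → Prop} (a : SteenrodAlgebra)
    (scalar : ∀ c : ZMod 2, p (algebraMap _ _ c)) (sq : ∀ n, p (Sq n))
    (mul : ∀ a b, p a → p b → p (a * b)) (add : ∀ a b, p a → p b → p (a + b)) : p a := by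
  obtain ⟨x, rfl⟩ := mk_surjective a
  induction x using FreeAlgebra.induction with
  | grade0 r => rw [AlgHom.commutes]; exact scalar r
  | grade1 n => exact sq n
  | mul a b ha hb => rw [map_mul]; exact mul _ _ ha hb
  | add a b ha hb => rw [map_add]; exact add _ _ ha hb

/-- The algebra map `Sqⁿ ↦ qₙ` determined by a sequence that satisfies the Bullett–Macdonald
relations. -/
def lift {E : Type*} [Ring E] [Algebra (ZMod 2) E] (q : ℕ → E) (h0 : q 0 = 1)
    (h : IsBullettMacdonald q) : SteenrodAlgebra →ₐ[ZMod 2] E :=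
  RingQuot.liftAlgHom (ZMod 2) ⟨FreeAlgebra.lift (ZMod 2) q, by
    intro x y hxy
    cases hxy with
    | sq_zero => simp [h0]
    | adem a b ha hab =>
      simp only [map_mul, map_sum, map_smul, FreeAlgebra.lift_ι_apply]
      exact (h (a + b)).adem hab⟩

theorem lift_Sq {E : Type*} [Ring E] [Algebra (ZMod 2) E] (q : ℕ → E) (h0 : q 0 = 1)
    (h : IsBullettMacdonald q) (n : ℕ) : lift q h0 h (Sq n) = q n :=
  (RingQuot.liftAlgHom_mkAlgHom_apply (ZMod 2) _ _ _).trans (FreeAlgebra.lift_ι_apply _ _)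

theorem isBullettMacdonald_Sq : IsBullettMacdonald Sq := by
  intro n
  apply bullettMacdonald_of_adem
  rintro a b rfl hab
  rcases Nat.eq_zero_or_pos a with rfl | ha
  · simp [Sq_zero]
  · have := RingQuot.mkAlgHom_rel (ZMod 2) (AdemRel.adem a b ha hab)
    simp only [map_mul, map_sum, map_smul] at this
    exact this

theorem augmentation_Sq (n : ℕ) : augmentation (Sq n) = if n = 0 then 1 else 0 :=
  (RingQuot.liftAlgHom_mkAlgHom_apply (ZMod 2) _ _ _).trans (FreeAlgebra.lift_ι_apply _ _)

end SteenrodAlgebra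

section SteenrodModules

variable {V W : Type*} [AddCommGroup V] [Module (ZMod 2) V] [Module SteenrodAlgebra V]
  [IsScalarTower (ZMod 2) SteenrodAlgebra V]

/-- A subspace that is stable under the Steenrod squares, as an `𝒜`-submodule. -/
def steenrodSubmodule (S : Submodule (ZMod 2) V) (h : ∀ n, ∀ x ∈ S, Sq n • x ∈ S) :
    Submodule SteenrodAlgebra V where
  toAddSubmonoid := S.toAddSubmonoid
  smul_mem' a x hx := by
    induction a using SteenrodAlgebra.induction_on generalizing x with
    | scalar c => rw [algebraMap_smul]; exact S.smul_mem c hx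
    | sq n => exact h n x hx
    | mul a b ha hb => rw [mul_smul]; exact ha _ (hb _ hx)
    | add a b ha hb => rw [add_smul]; exact S.add_mem (ha _ hx) (hb _ hx)

variable [AddCommGroup W] [Module (ZMod 2) W]
  [Module SteenrodAlgebra W] [IsScalarTower (ZMod 2) SteenrodAlgebra W]

theorem map_smul_of_map_Sq_smul (f : V →ₗ[ZMod 2] W)
    (h : ∀ n x, f (Sq n • x) = Sq n • f x) (a : SteenrodAlgebra) (x : V) :
    f (a • x) = a • f x := by
  induction a using SteenrodAlgebra.induction_on generalizing x with
  | scalar c => rw [algebraMap_smul, algebraMap_smul, map_smul]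
  | sq n => exact h n x
  | mul a b ha hb => rw [mul_smul, mul_smul, ha, hb]
  | add a b ha hb => rw [add_smul, add_smul, map_add, ha, hb]

/-- A linear map that commutes with the Steenrod squares, as an `𝒜`-linear map. -/
def steenrodLinear (f : V →ₗ[ZMod 2] W) (h : ∀ n x, f (Sq n • x) = Sq n • f x) :
    V →ₗ[SteenrodAlgebra] W :=
  { f with map_smul' := map_smul_of_map_Sq_smul f h }

end SteenrodModules

/-! ### Gradings -/

section GradedPart

variable {ι R V : Type*} [DecidableEq ι] [Ring R] [AddCommGroup V] [Module R V]
  {𝓥 : ι → Submodule R V}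

/-- The projection of a graded module to its homogeneous component of degree `p`. -/
def gradedPart (h : DirectSum.IsInternal 𝓥) (p : ι) : V →ₗ[R] V :=
  (𝓥 p).subtype ∘ₗ DirectSum.component R ι (fun p => 𝓥 p) p ∘ₗ
    (LinearEquiv.ofBijective (DirectSum.coeLinearMap 𝓥) h).symm.toLinearMap

theorem gradedPart_mem (h : DirectSum.IsInternal 𝓥) (p : ι) (x : V) : gradedPart h p x ∈ 𝓥 p :=
  Subtype.property _

theorem gradedPart_of_mem (h : DirectSum.IsInternal 𝓥) {p : ι} {x : V} (hx : x ∈ 𝓥 p) :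
    gradedPart h p x = x :=
  congrArg Subtype.val (h.ofBijective_coeLinearMap_of_mem hx)

theorem gradedPart_of_mem_ne (h : DirectSum.IsInternal 𝓥) {p q : ι} {x : V} (hx : x ∈ 𝓥 q)
    (hqp : q ≠ p) : gradedPart h p x = 0 :=
  congrArg Subtype.val (h.ofBijective_coeLinearMap_of_mem_ne hqp hx)

theorem homogeneous_induction (h : DirectSum.IsInternal 𝓥) {motive : V → Prop} (x : V)
    (zero : motive 0) (homogeneous : ∀ p, ∀ x ∈ 𝓥 p, motive x)
    (add : ∀ x y, motive x → motive y → motive (x + y)) : motive x := by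
  have hx : x ∈ ⨆ p, 𝓥 p := by rw [h.submodule_iSup_eq_top]; trivial
  induction hx using Submodule.iSup_induction' with
  | mem p x hx => exact homogeneous p x hx
  | zero => exact zero
  | add x y _ _ hx hy => exact add x y hx hy

theorem gradedPart_map {W F : Type*} [AddCommGroup W] [Module R W] [FunLike F V W]
    [AddMonoidHomClass F V W] {𝓦 : ι → Submodule R W} (h : DirectSum.IsInternal 𝓥)
    (h' : DirectSum.IsInternal 𝓦) (f : F) {σ : ι → ι} (hσ : Function.Injective σ)
    (hf : ∀ p, ∀ x ∈ 𝓥 p, f x ∈ 𝓦 (σ p)) (p : ι) (x : V) :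
    gradedPart h' (σ p) (f x) = f (gradedPart h p x) := by
  induction x using homogeneous_induction h with
  | zero => simp only [map_zero]
  | homogeneous q x hx =>
    rcases eq_or_ne q p with rfl | hne
    · rw [gradedPart_of_mem h hx, gradedPart_of_mem h' (hf _ x hx)]
    · rw [gradedPart_of_mem_ne h hx hne, map_zero,
        gradedPart_of_mem_ne h' (hf _ x hx) (hσ.ne hne)]
  | add x y hx hy => simp only [map_add, hx, hy]

variable {κ : Type*} (b : Basis κ R V) (dim : κ → ι)

theorem repr_eq_zero_of_mem (h : DirectSum.IsInternal 𝓥) (hb : ∀ k, b k ∈ 𝓥 (dim k)) {p : ι}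
    {x : V} (hx : x ∈ 𝓥 p) {k : κ} (hk : dim k ≠ p) : b.repr x k = 0 := by
  have hcoord : b.coord k ∘ₗ gradedPart h p = 0 := b.ext fun j => by
    rcases eq_or_ne (dim j) p with hj | hj
    · have hjk : j ≠ k := by
        rintro rfl
        exact hk hj
      rw [LinearMap.comp_apply, gradedPart_of_mem h (hj ▸ hb j), Basis.coord_apply,
        b.repr_self, Finsupp.single_eq_of_ne' hjk, LinearMap.zero_apply]
    · rw [LinearMap.comp_apply, gradedPart_of_mem_ne h (hb j) hj, map_zero, LinearMap.zero_apply]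
  simpa [gradedPart_of_mem h hx] using LinearMap.congr_fun hcoord x

theorem isInternal_of_basis (hb : ∀ k, b k ∈ 𝓥 (dim k))
    (h : ∀ p, ∀ x ∈ 𝓥 p, ∀ k, dim k ≠ p → b.repr x k = 0) : DirectSum.IsInternal 𝓥 := by
  rw [DirectSum.isInternal_submodule_iff_iSupIndep_and_iSup_eq_top]
  constructor
  · intro p
    rw [Submodule.disjoint_def]
    intro x hx hx'
    refine b.ext_elem fun k => ?_
    rw [map_zero, Finsupp.zero_apply]
    by_cases hk : dim k = p
    · have hle : (⨆ (q : ι) (_ : q ≠ p), 𝓥 q) ≤ LinearMap.ker (b.coord k) :=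
        iSup₂_le fun q hq y hy => h q y hy k (hk ▸ hq.symm)
      exact hle hx'
    · exact h p x hx k hk
  · rw [eq_top_iff, ← b.span_eq, Submodule.span_le]
    rintro _ ⟨k, rfl⟩
    exact Submodule.mem_iSup_of_mem (dim k) (hb k)

end GradedPart

section GradedSteenrod

variable {V W : Type*} [AddCommGroup V] [Module (ZMod 2) V] [Module SteenrodAlgebra V]
  [AddCommGroup W] [Module (ZMod 2) W] [Module SteenrodAlgebra W]
  {𝓥 : ℤ → Submodule (ZMod 2) V} {𝓦 : ℤ → Submodule (ZMod 2) W}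

theorem gradedPart_Sq_smul (h : IsGradedSteenrodModule 𝓥) (n : ℕ) (p : ℤ) (x : V) :
    gradedPart h.isInternal p (Sq n • x) = Sq n • gradedPart h.isInternal (p - n) x := by
  have := gradedPart_map h.isInternal h.isInternal (DistribSMul.toAddMonoidHom V (Sq n))
    (add_left_injective (n : ℤ)) (fun p x hx => h.sq_smul_mem n p x hx) (p - n) x
  rwa [sub_add_cancel] at this

theorem isGradedSteenrodModule_concentrated (t : ℤ) :
    IsGradedSteenrodModule (M := ZMod 2) fun p => if p = t then ⊤ else ⊥ where
  isInternal := by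
    refine isInternal_of_basis (Basis.singleton Unit (ZMod 2)) (fun _ => t) (fun _ => ?_)
      fun p x hx k hk => ?_
    · rw [if_pos rfl]
      trivial
    · rw [if_neg (Ne.symm hk)] at hx
      rw [Basis.singleton_repr]
      exact hx
  sq_smul_mem i p x hx := by
    rw [SteenrodAlgebra.smul_zmod, SteenrodAlgebra.augmentation_Sq]
    rcases eq_or_ne i 0 with rfl | hi
    · simpa using hx
    · rw [if_neg hi, zero_mul]
      exact Submodule.zero_mem _

variable [IsScalarTower (ZMod 2) SteenrodAlgebra V] [IsScalarTower (ZMod 2) SteenrodAlgebra W]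

theorem map_gradedPart_of_generators (h : IsGradedSteenrodModule 𝓥)
    (h' : IsGradedSteenrodModule 𝓦) {ι : Type*} {g : ι → V}
    (hg : ⊤ ≤ Submodule.span SteenrodAlgebra (Set.range g)) {deg : ι → ℤ}
    (hdeg : ∀ j, g j ∈ 𝓥 (deg j)) (f : V →ₗ[SteenrodAlgebra] W) (hf : ∀ j, f (g j) ∈ 𝓦 (deg j))
    (p : ℤ) (x : V) : f (gradedPart h.isInternal p x) = gradedPart h'.isInternal p (f x) := by
  let S : Submodule (ZMod 2) V := ⨅ p, LinearMap.eqLocus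
    (f.restrictScalars (ZMod 2) ∘ₗ gradedPart h.isInternal p)
    (gradedPart h'.isInternal p ∘ₗ f.restrictScalars (ZMod 2))
  have mem_S {y : V} : y ∈ S ↔
      ∀ p, f (gradedPart h.isInternal p y) = gradedPart h'.isInternal p (f y) :=
    Submodule.mem_iInf _
  have hSq : ∀ n, ∀ y ∈ S, Sq n • y ∈ S := fun n y hy => mem_S.2 fun p => by
    rw [gradedPart_Sq_smul h, map_smul, map_smul, gradedPart_Sq_smul h', mem_S.1 hy]
  have hgen : ∀ j, g j ∈ S := fun j => mem_S.2 fun p => by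
    rcases eq_or_ne (deg j) p with rfl | hj
    · rw [gradedPart_of_mem _ (hdeg j), gradedPart_of_mem _ (hf j)]
    · rw [gradedPart_of_mem_ne _ (hdeg j) hj, gradedPart_of_mem_ne _ (hf j) hj, map_zero]
  have hle : Submodule.span SteenrodAlgebra (Set.range g) ≤ steenrodSubmodule S hSq :=
    Submodule.span_le.2 (Set.range_subset_iff.2 hgen)
  exact mem_S.1 (hle (hg trivial)) p

theorem map_mem_of_generators (h : IsGradedSteenrodModule 𝓥) (h' : IsGradedSteenrodModule 𝓦)
    {ι : Type*} {g : ι → V} (hg : ⊤ ≤ Submodule.span SteenrodAlgebra (Set.range g))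
    {deg : ι → ℤ} (hdeg : ∀ j, g j ∈ 𝓥 (deg j)) (f : V →ₗ[SteenrodAlgebra] W)
    (hf : ∀ j, f (g j) ∈ 𝓦 (deg j)) (p : ℤ) (x : V) (hx : x ∈ 𝓥 p) : f x ∈ 𝓦 p := by
  rw [← gradedPart_of_mem h.isInternal hx, map_gradedPart_of_generators h h' hg hdeg f hf]
  exact gradedPart_mem _ _ _

theorem exists_graded_lift {U : Type*} [AddCommGroup U] [Module (ZMod 2) U]
    [Module SteenrodAlgebra U] {𝓤 : ℤ → Submodule (ZMod 2) U}
    (h : IsGradedSteenrodModule 𝓥) (h' : IsGradedSteenrodModule 𝓦)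
    (h'' : DirectSum.IsInternal 𝓤)
    {ι : Type*} (b : Basis ι SteenrodAlgebra V) {deg : ι → ℤ} (hb : ∀ j, b j ∈ 𝓥 (deg j))
    (α : V →ₗ[SteenrodAlgebra] U) (hα : ∀ p, ∀ x ∈ 𝓥 p, α x ∈ 𝓤 p)
    (β : W →ₗ[SteenrodAlgebra] U) (hβ : ∀ p, ∀ x ∈ 𝓦 p, β x ∈ 𝓤 p)
    (hαβ : ∀ x, ∃ y, β y = α x) :
    ∃ γ : V →ₗ[SteenrodAlgebra] W, (∀ p, ∀ x ∈ 𝓥 p, γ x ∈ 𝓦 p) ∧ ∀ x, β (γ x) = α x := by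
  have hlift : ∀ j, ∃ y ∈ 𝓦 (deg j), β y = α (b j) := by
    intro j
    obtain ⟨y, hy⟩ := hαβ (b j)
    refine ⟨gradedPart h'.isInternal (deg j) y, gradedPart_mem _ _ _, ?_⟩
    rw [← gradedPart_map h'.isInternal h'' β Function.injective_id hβ (deg j) y, id, hy,
      gradedPart_of_mem _ (hα _ _ (hb j))]
  choose y hy hβy using hlift
  have hγ : ∀ j, b.constr ℕ y (b j) = y j := b.constr_basis ℕ y
  have hcomp : β ∘ₗ b.constr ℕ y = α := b.ext fun j => by rw [LinearMap.comp_apply, hγ, hβy]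
  exact ⟨b.constr ℕ y, map_mem_of_generators h h' b.span_eq.ge hb _ fun j => (hγ j).symm ▸ hy j,
    LinearMap.congr_fun hcomp⟩

end GradedSteenrod

/-! ### The diagonal action -/

section DiagonalTensor

variable (N F : Type*) [AddCommGroup N] [Module (ZMod 2) N] [AddCommGroup F] [Module (ZMod 2) F]

/-- The tensor product `N ⊗ F` as an `𝒜`-module by the diagonal action. It is a type of its own
because `N ⊗ F` already carries the action of `𝒜` on the left factor. -/
def DiagonalTensor : Type _ := N ⊗[ZMod 2] F

namespace DiagonalTensor

instance : AddCommGroup (DiagonalTensor N F) := inferInstanceAs (AddCommGroup (N ⊗[ZMod 2] F))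

instance : Module (ZMod 2) (DiagonalTensor N F) :=
  inferInstanceAs (Module (ZMod 2) (N ⊗[ZMod 2] F))

/-- The identification of `DiagonalTensor N F` with the underlying tensor product. -/
def equiv : DiagonalTensor N F ≃ₗ[ZMod 2] N ⊗[ZMod 2] F := LinearEquiv.refl _ _

variable {N F}

/-- The pure tensor `x ⊗ y`, as a bilinear map. -/
def tmul : N →ₗ[ZMod 2] F →ₗ[ZMod 2] DiagonalTensor N F := TensorProduct.mk (ZMod 2) N F

theorem induction_on {motive : DiagonalTensor N F → Prop} (z : DiagonalTensor N F)
    (zero : motive 0) (tmul : ∀ x y, motive (tmul x y))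
    (add : ∀ z w, motive z → motive w → motive (z + w)) : motive z :=
  TensorProduct.induction_on z zero tmul add

theorem tmul_mem_of_mem_span {T : Submodule (ZMod 2) (DiagonalTensor N F)} {s : Set N} {x : N}
    (hx : x ∈ Submodule.span (ZMod 2) s) {y : F} (hT : ∀ x ∈ s, tmul x y ∈ T) : tmul x y ∈ T :=
  (Submodule.span_le.2 hT : _ ≤ T.comap ((tmul (N := N) (F := F)).flip y)) hx

/-- The coordinate in `F` of an element of `N ⊗ F` at the basis element `k` of `N`. -/
def cellCoord {κ : Type*} (e : Basis κ (ZMod 2) N) (k : κ) : DiagonalTensor N F →ₗ[ZMod 2] F :=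
  (TensorProduct.lid (ZMod 2) F).toLinearMap ∘ₗ LinearMap.rTensor F (e.coord k) ∘ₗ
    (equiv N F).toLinearMap

theorem cellCoord_tmul {κ : Type*} (e : Basis κ (ZMod 2) N) (k : κ) (x : N) (y : F) :
    cellCoord e k (tmul x y) = e.repr x k • y :=
  TensorProduct.lid_tmul _ _

end DiagonalTensor

end DiagonalTensor

section Diagonal

open SteenrodAlgebra Finset

variable (N F : Type*) [AddCommGroup N] [Module (ZMod 2) N] [Module SteenrodAlgebra N]
  [IsScalarTower (ZMod 2) SteenrodAlgebra N] [AddCommGroup F] [Module (ZMod 2) F]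
  [Module SteenrodAlgebra F] [IsScalarTower (ZMod 2) SteenrodAlgebra F]

theorem isBullettMacdonald_map {E : Type*} [Ring E] [Algebra (ZMod 2) E]
    (f : SteenrodAlgebra →ₗ[ZMod 2] E) (hf : ∀ a b, f (a * b) = f a * f b) :
    IsBullettMacdonald fun n => f (Sq n) := fun n => by
  simpa only [hf] using (isBullettMacdonald_Sq n).map f

theorem cartanSq_eq_cauchyProduct (n : ℕ) : cartanSq N F n =
    cauchyProduct (E := Module.End (ZMod 2) (N ⊗[ZMod 2] F))
      (fun n => LinearMap.rTensor F (Algebra.lsmul (ZMod 2) (ZMod 2) N (Sq n)))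
      (fun n => LinearMap.lTensor N (Algebra.lsmul (ZMod 2) (ZMod 2) F (Sq n))) n := by
  rw [cartanSq, cauchyProduct]
  refine Finset.sum_congr rfl fun p _ => ?_
  rw [Module.End.mul_eq_comp, LinearMap.rTensor_comp_lTensor]

theorem isBullettMacdonald_cartanSq :
    IsBullettMacdonald (E := Module.End (ZMod 2) (N ⊗[ZMod 2] F)) (cartanSq N F) := by
  rw [funext (cartanSq_eq_cauchyProduct N F)]
  apply IsBullettMacdonald.cauchyProduct
  · refine isBullettMacdonald_map (E := Module.End (ZMod 2) (N ⊗[ZMod 2] F))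
      (LinearMap.rTensorHom F ∘ₗ (Algebra.lsmul (ZMod 2) (ZMod 2) N).toLinearMap) fun a b => ?_
    simp [Module.End.mul_eq_comp, LinearMap.rTensor_comp]
  · refine isBullettMacdonald_map (E := Module.End (ZMod 2) (N ⊗[ZMod 2] F))
      (LinearMap.lTensorHom N ∘ₗ (Algebra.lsmul (ZMod 2) (ZMod 2) F).toLinearMap) fun a b => ?_
    simp [Module.End.mul_eq_comp, LinearMap.lTensor_comp]
  · intro i j
    rw [commute_iff_eq, Module.End.mul_eq_comp, Module.End.mul_eq_comp,
      LinearMap.rTensor_comp_lTensor, LinearMap.lTensor_comp_rTensor]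

theorem cartanSq_zero : cartanSq N F 0 = LinearMap.id := by
  ext x y
  simp [cartanSq, Sq_zero]

/-- The diagonal action of `𝒜` on `N ⊗ F`, given on the Steenrod squares by the Cartan formula. -/
def diagonalAction : SteenrodAlgebra →ₐ[ZMod 2] Module.End (ZMod 2) (N ⊗[ZMod 2] F) :=
  SteenrodAlgebra.lift (cartanSq N F) (cartanSq_zero N F) (isBullettMacdonald_cartanSq N F)

namespace DiagonalTensor

instance : Module SteenrodAlgebra (DiagonalTensor N F) :=
  letI : Module (Module.End (ZMod 2) (N ⊗[ZMod 2] F)) (DiagonalTensor N F) :=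
    inferInstanceAs (Module (Module.End (ZMod 2) (N ⊗[ZMod 2] F)) (N ⊗[ZMod 2] F))
  Module.compHom _ (diagonalAction N F).toRingHom

theorem smul_def (a : SteenrodAlgebra) (z : DiagonalTensor N F) :
    a • z = (diagonalAction N F a : N ⊗[ZMod 2] F →ₗ[ZMod 2] N ⊗[ZMod 2] F) z := rfl

instance : IsScalarTower (ZMod 2) SteenrodAlgebra (DiagonalTensor N F) where
  smul_assoc c a x := by
    rw [smul_def, map_smul]
    rfl

theorem Sq_smul (n : ℕ) (z : DiagonalTensor N F) :
    equiv N F (Sq n • z) = cartanSq N F n (equiv N F z) := by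
  rw [smul_def, diagonalAction, lift_Sq]
  rfl

variable {N F}

theorem Sq_smul_tmul (n : ℕ) (x : N) (y : F) :
    Sq n • tmul x y = ∑ p ∈ antidiagonal n, tmul (Sq p.1 • x) (Sq p.2 • y) := by
  refine (Sq_smul N F n (tmul x y)).trans ?_
  rw [cartanSq, LinearMap.sum_apply]
  rfl

theorem Sq_smul_tmul_sub_mem {T : Submodule (ZMod 2) (DiagonalTensor N F)} {x : N}
    (hT : ∀ i, 0 < i → ∀ y : F, tmul (Sq i • x) y ∈ T) (n : ℕ) (y : F) :
    Sq n • tmul x y - tmul x (Sq n • y) ∈ T := by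
  have h0n : ((0, n) : ℕ × ℕ) ∈ antidiagonal n := by simp
  rw [Sq_smul_tmul, ← add_sum_erase _ _ h0n, Sq_zero, one_smul, add_sub_cancel_left]
  refine sum_mem fun p hp => hT _ (Nat.pos_of_ne_zero fun hp1 => ?_) _
  obtain ⟨hne, hp⟩ := mem_erase.1 hp
  exact hne (Prod.ext hp1 (by simpa [hp1] using hp))

theorem smul_tmul_sub_mem {T : Submodule SteenrodAlgebra (DiagonalTensor N F)} {x : N}
    (hT : ∀ i, 0 < i → ∀ y : F, tmul (Sq i • x) y ∈ T) (a : SteenrodAlgebra) (y : F) :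
    a • tmul x y - tmul x (a • y) ∈ T := by
  induction a using SteenrodAlgebra.induction_on generalizing y with
  | scalar c => simp [algebraMap_smul]
  | sq n => exact Sq_smul_tmul_sub_mem (T := T.restrictScalars (ZMod 2)) hT n y
  | mul a b ha hb =>
    have := T.add_mem (T.smul_mem a (hb y)) (ha (b • y))
    rwa [smul_sub, sub_add_sub_cancel, ← mul_smul, ← mul_smul] at this
  | add a b ha hb =>
    have := T.add_mem (ha y) (hb y)
    rwa [sub_add_sub_comm, ← add_smul, ← map_add, ← add_smul] at this

end DiagonalTensor

end Diagonal

/-! ### Cellular bases -/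

section Cellular

open SteenrodAlgebra Finset

variable {N F κ ι : Type*} [AddCommGroup N] [Module (ZMod 2) N] [Module SteenrodAlgebra N]
  [AddCommGroup F] [Module (ZMod 2) F] [Module SteenrodAlgebra F]

/-- A family of elements of an `𝒜`-module, thought of as the cells of a spectrum, is cellular if
every `Sq^n` with `n > 0` maps each cell to a combination of later cells. -/
def IsCellular [Preorder κ] (e : κ → N) : Prop :=
  ∀ k n, 0 < n → Sq n • e k ∈ Submodule.span (ZMod 2) (e '' Set.Ioi k)

theorem isCellular_of_monotone [LinearOrder κ] {𝓝 : ℤ → Submodule (ZMod 2) N}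
    (h𝓝 : IsGradedSteenrodModule 𝓝) (e : Basis κ (ZMod 2) N) {dim : κ → ℤ} (hdim : Monotone dim)
    (he : ∀ k, e k ∈ 𝓝 (dim k)) : IsCellular e := by
  intro k n hn
  rw [Basis.mem_span_image]
  intro l hl
  by_contra hlk
  have hle : dim l ≤ dim k := hdim (not_lt.1 hlk)
  exact Finsupp.mem_support_iff.1 hl (repr_eq_zero_of_mem e dim h𝓝.isInternal he
    (h𝓝.sq_smul_mem n _ _ (he k)) (by omega))

theorem IsCellular.Sq_smul_mem_span [Preorder κ] {e : κ → N} (he : IsCellular e) {k l : κ}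
    (hkl : k < l) (n : ℕ) : Sq n • e l ∈ Submodule.span (ZMod 2) (e '' Set.Ioi k) := by
  rcases n.eq_zero_or_pos with rfl | hn
  · rw [Sq_zero, one_smul]
    exact Submodule.subset_span (Set.mem_image_of_mem e hkl)
  · exact Submodule.span_mono (Set.image_mono (Set.Ioi_subset_Ioi hkl.le)) (he l n hn)

variable [IsScalarTower (ZMod 2) SteenrodAlgebra N] [IsScalarTower (ZMod 2) SteenrodAlgebra F]

namespace DiagonalTensor

theorem span_tmul_eq_top [Preorder κ] [WellFoundedGT κ] {e : κ → N}
    (he : IsCellular e) (he_top : ⊤ ≤ Submodule.span (ZMod 2) (Set.range e)) {r : ι → F}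
    (hr_top : ⊤ ≤ Submodule.span SteenrodAlgebra (Set.range r)) :
    Submodule.span SteenrodAlgebra (Set.range fun p : κ × ι => tmul (e p.1) (r p.2)) = ⊤ := by
  set T := Submodule.span SteenrodAlgebra (Set.range fun p : κ × ι => tmul (e p.1) (r p.2))
  have cell_mem : ∀ k y, tmul (e k) y ∈ T := by
    intro k
    induction k using WellFoundedGT.induction with
    | ind k later_mem =>
      have hT : ∀ i, 0 < i → ∀ y : F, tmul (Sq i • e k) y ∈ T := fun i hi y => by
        refine tmul_mem_of_mem_span (T := T.restrictScalars (ZMod 2)) (he k i hi) ?_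
        rintro _ ⟨l, hl, rfl⟩
        exact later_mem l hl y
      intro y
      induction hr_top (Submodule.mem_top (x := y)) using Submodule.span_induction with
      | mem y hy =>
        obtain ⟨j, rfl⟩ := hy
        exact Submodule.subset_span ⟨(k, j), rfl⟩
      | zero => rw [map_zero]; exact T.zero_mem
      | add y y' _ _ hy hy' => rw [map_add]; exact T.add_mem hy hy'
      | smul a y _ hy => exact (T.sub_mem_iff_right (T.smul_mem a hy)).1 (smul_tmul_sub_mem hT a y)
  rw [eq_top_iff]
  rintro z -
  induction z using induction_on with
  | zero => exact T.zero_mem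
  | tmul x y =>
    refine tmul_mem_of_mem_span (T := T.restrictScalars (ZMod 2)) (he_top trivial) ?_
    rintro _ ⟨k, rfl⟩
    exact cell_mem k y
  | add z w hz hw => exact T.add_mem hz hw

/-- The part of `N ⊗ F` that lies over the cells beyond `k`. -/
def beyondCell [Preorder κ] (F : Type*) [AddCommGroup F] [Module (ZMod 2) F]
    [Module SteenrodAlgebra F] [IsScalarTower (ZMod 2) SteenrodAlgebra F] {e : κ → N}
    (he : IsCellular e) (k : κ) : Submodule SteenrodAlgebra (DiagonalTensor N F) :=
  steenrodSubmodule (Submodule.span (ZMod 2) (Set.image2 (fun x y => tmul x y)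
      (e '' Set.Ioi k) Set.univ)) fun n z hz => by
    induction hz using Submodule.span_induction with
    | mem z hz =>
      obtain ⟨_, ⟨l, hl, rfl⟩, y, -, rfl⟩ := hz
      rw [Sq_smul_tmul]
      exact sum_mem fun p _ => tmul_mem_of_mem_span (he.Sq_smul_mem_span hl p.1) fun x hx =>
        Submodule.subset_span ⟨x, hx, _, trivial, rfl⟩
    | zero => rw [smul_zero]; exact Submodule.zero_mem _
    | add z w _ _ hz hw => rw [smul_add]; exact Submodule.add_mem _ hz hw
    | smul c z _ hz => rw [smul_comm]; exact Submodule.smul_mem _ _ hz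

theorem tmul_mem_beyondCell [Preorder κ] {e : κ → N} (he : IsCellular e) {k : κ} {x : N}
    (hx : x ∈ Submodule.span (ZMod 2) (e '' Set.Ioi k)) (y : F) : tmul x y ∈ beyondCell F he k :=
  tmul_mem_of_mem_span (T := (beyondCell F he k).restrictScalars (ZMod 2)) hx fun x hx =>
    Submodule.subset_span ⟨x, hx, y, trivial, rfl⟩

theorem cellCoord_of_mem_beyondCell [Preorder κ] {e : Basis κ (ZMod 2) N} (he : IsCellular e)
    {k : κ} {z : DiagonalTensor N F} (hz : z ∈ beyondCell F he k) : cellCoord e k z = 0 := by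
  refine (Submodule.span_le.2 ?_ : _ ≤ LinearMap.ker (cellCoord e k)) hz
  rintro _ ⟨_, ⟨l, hl, rfl⟩, y, -, rfl⟩
  change cellCoord e k (tmul (e l) y) = 0
  rw [cellCoord_tmul, e.repr_self, Finsupp.single_eq_of_ne' (ne_of_gt hl), zero_smul]

theorem cellCoord_smul_tmul_self [Preorder κ] {e : Basis κ (ZMod 2) N} (he : IsCellular e)
    (k : κ) (a : SteenrodAlgebra) (y : F) : cellCoord e k (a • tmul (e k) y) = a • y := by
  have := cellCoord_of_mem_beyondCell he
    (smul_tmul_sub_mem (fun i hi y => tmul_mem_beyondCell he (he k i hi) y) a y)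
  rwa [map_sub, sub_eq_zero, cellCoord_tmul, e.repr_self, Finsupp.single_eq_same, one_smul] at this

theorem cellCoord_smul_tmul_of_lt [Preorder κ] {e : Basis κ (ZMod 2) N} (he : IsCellular e)
    {k l : κ} (hkl : k < l) (a : SteenrodAlgebra) (y : F) :
    cellCoord e k (a • tmul (e l) y) = 0 :=
  cellCoord_of_mem_beyondCell he ((beyondCell F he k).smul_mem a (tmul_mem_beyondCell he
    (Submodule.subset_span (Set.mem_image_of_mem e hkl)) y))

theorem linearIndependent_tmul [LinearOrder κ] {e : Basis κ (ZMod 2) N} (he : IsCellular e)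
    {r : ι → F} (hr : LinearIndependent SteenrodAlgebra r) :
    LinearIndependent SteenrodAlgebra fun p : κ × ι => tmul (e p.1) (r p.2) := by
  classical
  rw [linearIndependent_iff]
  intro c hc
  by_contra hne
  obtain ⟨⟨k, j⟩, hkj, hmin⟩ :=
    c.support.exists_min_image Prod.fst (Finsupp.support_nonempty_iff.2 hne)
  have hcoord : ∀ p ∈ c.support,
      cellCoord e k (c p • tmul (e p.1) (r p.2)) = if p.1 = k then c p • r p.2 else 0 := by
    rintro ⟨l, i⟩ hp
    rcases (hmin _ hp).eq_or_lt with rfl | hkl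
    · rw [cellCoord_smul_tmul_self he, if_pos rfl]
    · rw [cellCoord_smul_tmul_of_lt he hkl, if_neg hkl.ne']
  have hsum : ∑ p ∈ c.support with p.1 = k, c (k, p.2) • r p.2 = 0 := by
    have := congrArg (cellCoord e k) hc
    rw [Finsupp.linearCombination_apply, Finsupp.sum, map_sum, sum_congr rfl hcoord, map_zero,
      ← sum_filter] at this
    rw [← this]
    refine sum_congr rfl fun p hp => ?_
    rw [← (mem_filter.1 hp).2]
  rw [← sum_image (f := fun i => c (k, i) • r i) (g := Prod.snd)] at hsum
  · exact Finsupp.mem_support_iff.1 hkj (linearIndependent_iff'.1 hr _ (fun i => c (k, i)) hsum j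
      (mem_image.2 ⟨(k, j), mem_filter.2 ⟨hkj, rfl⟩, rfl⟩))
  · rintro ⟨_, i⟩ hp ⟨_, i'⟩ hp' rfl
    exact Prod.ext ((mem_filter.1 hp).2.trans (mem_filter.1 hp').2.symm) rfl

/-- The `𝒜`-basis of the `e k ⊗ r j`. -/
def basis [LinearOrder κ] [WellFoundedGT κ] (e : Basis κ (ZMod 2) N) (he : IsCellular e)
    (r : Basis ι SteenrodAlgebra F) : Basis (κ × ι) SteenrodAlgebra (DiagonalTensor N F) :=
  Basis.mk (linearIndependent_tmul he r.linearIndependent)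
    (span_tmul_eq_top he e.span_eq.ge r.span_eq.ge).ge

theorem basis_apply [LinearOrder κ] [WellFoundedGT κ] (e : Basis κ (ZMod 2) N)
    (he : IsCellular e) (r : Basis ι SteenrodAlgebra F) (p : κ × ι) :
    basis e he r p = tmul (e p.1) (r p.2) :=
  Basis.mk_apply _ _ p

end DiagonalTensor

end Cellular

/-! ### Comparison of resolutions -/

theorem exists_dependent_sequence {α : ℕ → Type*} (good : ∀ i, α i → Prop)
    (rel : ∀ i, α i → α (i + 1) → Prop) (a₀ : α 0) (h₀ : good 0 a₀)
    (step : ∀ i a, good i a → ∃ a', good (i + 1) a' ∧ rel i a a') :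
    ∃ f : ∀ i, α i, f 0 = a₀ ∧ ∀ i, good i (f i) ∧ rel i (f i) (f (i + 1)) := by
  choose next hgood hrel using step
  let f : ∀ i, {a : α i // good i a} := fun i =>
    Nat.rec ⟨a₀, h₀⟩ (fun i a => ⟨next i a.1 a.2, hgood i a.1 a.2⟩) i
  exact ⟨fun i => (f i).1, rfl, fun i => ⟨(f i).2, hrel i (f i).1 (f i).2⟩⟩

section Cohomology

variable {X X' : ℕ → Type*} [∀ i, AddCommGroup (X i)] [∀ i, Module (ZMod 2) (X i)]
  [∀ i, AddCommGroup (X' i)] [∀ i, Module (ZMod 2) (X' i)]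
  (δ : ∀ i, X i →ₗ[ZMod 2] X (i + 1)) (δ' : ∀ i, X' i →ₗ[ZMod 2] X' (i + 1))

variable {δ δ'} in
theorem map_coboundaries (α : ∀ i, X i →ₗ[ZMod 2] X' i)
    (hα : ∀ i x, α (i + 1) (δ i x) = δ' i (α i x)) (s : ℕ) {x : X s} (hx : x ∈ coboundaries δ s) :
    α s x ∈ coboundaries δ' s := by
  cases s with
  | zero =>
    obtain rfl : x = 0 := hx
    rw [map_zero]
    exact Submodule.zero_mem _
  | succ s =>
    obtain ⟨y, rfl⟩ := hx
    exact ⟨α s y, (hα s y).symm⟩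

/-- The map on cohomology induced by a cochain map. -/
def cohomologyMap (α : ∀ i, X i →ₗ[ZMod 2] X' i)
    (hα : ∀ i x, α (i + 1) (δ i x) = δ' i (α i x)) (s : ℕ) :
    Cohomology δ s →ₗ[ZMod 2] Cohomology δ' s :=
  Submodule.mapQ _ _ ((α s).restrict (p := cocycles δ s) (q := cocycles δ' s) fun x hx => by
    rw [LinearMap.mem_ker] at hx ⊢
    rw [← hα, hx, map_zero]) fun _ hx => map_coboundaries α hα s hx

theorem nonempty_cohomology_equiv (α : ∀ i, X i →ₗ[ZMod 2] X' i)
    (hα : ∀ i x, α (i + 1) (δ i x) = δ' i (α i x)) (β : ∀ i, X' i →ₗ[ZMod 2] X i)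
    (hβ : ∀ i x, β (i + 1) (δ' i x) = δ i (β i x)) (s : ℕ)
    (hβα : ∀ x, δ s x = 0 → β s (α s x) - x ∈ coboundaries δ s)
    (hαβ : ∀ x, δ' s x = 0 → α s (β s x) - x ∈ coboundaries δ' s) :
    Nonempty (Cohomology δ s ≃ₗ[ZMod 2] Cohomology δ' s) := by
  refine ⟨LinearEquiv.ofLinearMap (cohomologyMap δ δ' α hα s) (cohomologyMap δ' δ β hβ s) ?_ ?_⟩
  · refine LinearMap.ext fun z => ?_
    obtain ⟨⟨x, hx⟩, rfl⟩ := Submodule.Quotient.mk_surjective _ z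
    exact (Submodule.Quotient.eq _).2 (hαβ x hx)
  · refine LinearMap.ext fun z => ?_
    obtain ⟨⟨x, hx⟩, rfl⟩ := Submodule.Quotient.mk_surjective _ z
    exact (Submodule.Quotient.eq _).2 (hβα x hx)

end Cohomology

section Comparison

variable {N : Type*} [AddCommGroup N] [Module (ZMod 2) N] [Module SteenrodAlgebra N]
  {𝓝 : ℤ → Submodule (ZMod 2) N}

theorem GradedFreeResolution.exists_chainMap (hN : DirectSum.IsInternal 𝓝)
    (P : GradedFreeResolution.{v, w} 𝓝) (P' : GradedFreeResolution.{v', w'} 𝓝) :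
    ∃ φ : ∀ i, P.obj i →ₗ[SteenrodAlgebra] P'.obj i,
      (∀ i p, ∀ x ∈ P.grading i p, φ i x ∈ P'.grading i p) ∧
      (∀ x, P'.aug (φ 0 x) = P.aug x) ∧ ∀ i x, P'.d i (φ (i + 1) x) = φ i (P.d i x) := by
  obtain ⟨φ₀, hφ₀, hφ₀'⟩ := exists_graded_lift (P.isGraded 0) (P'.isGraded 0) hN (P.gen 0)
    (P.gen_mem 0) P.aug P.aug_mem P'.aug P'.aug_mem fun x => P'.aug_surjective _
  obtain ⟨φ, h0, h⟩ := exists_dependent_sequence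
    (α := fun i => P.obj i →ₗ[SteenrodAlgebra] P'.obj i)
    (fun i φ => (∀ p, ∀ x ∈ P.grading i p, φ x ∈ P'.grading i p) ∧
      ∀ x, ∃ y, P'.d i y = φ (P.d i x))
    (fun i φ φ' => ∀ x, P'.d i (φ' x) = φ (P.d i x)) φ₀
    ⟨hφ₀, fun x => (P'.exact_zero _).1 (by rw [hφ₀', (P.exact_zero _).2 ⟨x, rfl⟩])⟩
    (fun i φ hφ => by
      obtain ⟨φ', h1, h2⟩ := exists_graded_lift (P.isGraded (i + 1)) (P'.isGraded (i + 1))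
        (P'.isGraded i).isInternal (P.gen (i + 1)) (P.gen_mem (i + 1))
        (φ ∘ₗ P.d i) (fun p x hx => hφ.1 p _ (P.d_mem i p x hx)) (P'.d i) (P'.d_mem i) hφ.2
      refine ⟨φ', ⟨h1, fun x => (P'.exact i _).1 ?_⟩, h2⟩
      rw [h2, LinearMap.comp_apply, (P.exact i _).2 ⟨x, rfl⟩, map_zero])
  exact ⟨φ, fun i => (h i).1.1, fun x => by rw [h0, hφ₀'], fun i => (h i).2⟩

theorem GradedFreeResolution.exists_homotopy (P : GradedFreeResolution.{v, w} 𝓝)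
    (θ : ∀ i, P.obj i →ₗ[SteenrodAlgebra] P.obj i)
    (hgr : ∀ i p, ∀ x ∈ P.grading i p, θ i x ∈ P.grading i p)
    (haug : ∀ x, P.aug (θ 0 x) = 0) (hd : ∀ i x, P.d i (θ (i + 1) x) = θ i (P.d i x)) :
    ∃ h : ∀ i, P.obj i →ₗ[SteenrodAlgebra] P.obj (i + 1),
      (∀ i p, ∀ x ∈ P.grading i p, h i x ∈ P.grading (i + 1) p) ∧
      (∀ x, θ 0 x = P.d 0 (h 0 x)) ∧
      ∀ i x, θ (i + 1) x = P.d (i + 1) (h (i + 1) x) + h i (P.d i x) := by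
  obtain ⟨h₀, hh₀, hh₀'⟩ := exists_graded_lift (P.isGraded 0) (P.isGraded 1)
    (P.isGraded 0).isInternal (P.gen 0) (P.gen_mem 0) (θ 0) (hgr 0) (P.d 0) (P.d_mem 0)
    fun x => (P.exact_zero _).1 (haug x)
  obtain ⟨h, h0, h'⟩ := exists_dependent_sequence
    (α := fun i => P.obj i →ₗ[SteenrodAlgebra] P.obj (i + 1))
    (fun i h => (∀ p, ∀ x ∈ P.grading i p, h x ∈ P.grading (i + 1) p) ∧
      ∀ x, P.d i (h (P.d i x)) = θ i (P.d i x))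
    (fun i h h' => ∀ x, P.d (i + 1) (h' x) = θ (i + 1) x - h (P.d i x)) h₀
    ⟨hh₀, fun x => by rw [hh₀']⟩
    (fun i h hh => by
      obtain ⟨h', h1, h2⟩ := exists_graded_lift (P.isGraded (i + 1)) (P.isGraded (i + 2))
        (P.isGraded (i + 1)).isInternal (P.gen (i + 1)) (P.gen_mem (i + 1))
        (θ (i + 1) - h ∘ₗ P.d i) (fun p x hx => Submodule.sub_mem _ (hgr _ p x hx)
          (hh.1 p _ (P.d_mem i p x hx))) (P.d (i + 1)) (P.d_mem (i + 1))
        (fun x => (P.exact i _).1 (by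
          rw [LinearMap.sub_apply, map_sub, hd, LinearMap.comp_apply, hh.2, sub_self]))
      refine ⟨h', ⟨h1, fun x => ?_⟩, h2⟩
      rw [h2, LinearMap.sub_apply, LinearMap.comp_apply, (P.exact i _).2 ⟨x, rfl⟩, map_zero,
        sub_zero])
  refine ⟨h, fun i => (h' i).1.1, fun x => by rw [h0, hh₀'], fun i x => ?_⟩
  rw [(h' i).2, sub_add_cancel]

/-- Composition with a graded `𝒜`-linear map. -/
def resolutionHomPrecomp {N' : Type*} [AddCommGroup N'] [Module (ZMod 2) N']
    [Module SteenrodAlgebra N'] {𝓝' : ℤ → Submodule (ZMod 2) N'}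
    (P : GradedFreeResolution.{v, w} 𝓝) (P' : GradedFreeResolution.{v', w'} 𝓝') (t : ℤ)
    {i j : ℕ} (φ : P.obj i →ₗ[SteenrodAlgebra] P'.obj j)
    (hφ : ∀ p, ∀ x ∈ P.grading i p, φ x ∈ P'.grading j p) :
    resolutionHom P' t j →ₗ[ZMod 2] resolutionHom P t i :=
  (LinearMap.lcomp (ZMod 2) (ZMod 2) (φ.restrictScalars (ZMod 2))).restrict (by
    rintro f ⟨hf, hf'⟩
    refine ⟨fun a x => ?_, fun p hp x hx => ?_⟩
    · simp [hf]
    · simpa using hf' p hp _ (hφ p x hx))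

theorem resolutionHomD_apply (P : GradedFreeResolution.{v, w} 𝓝) (t : ℤ) (i : ℕ)
    (f : resolutionHom P t i) (x : P.obj (i + 1)) :
    (resolutionHomD P t i f).1 x = f.1 (P.d i x) := rfl

theorem resolutionHom_homotopy (P : GradedFreeResolution.{v, w} 𝓝)
    (φ : ∀ i, P.obj i →ₗ[SteenrodAlgebra] P.obj i)
    (hgr : ∀ i p, ∀ x ∈ P.grading i p, φ i x ∈ P.grading i p)
    (haug : ∀ x, P.aug (φ 0 x) = P.aug x) (hd : ∀ i x, P.d i (φ (i + 1) x) = φ i (P.d i x))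
    (t : ℤ) (s : ℕ) (f : resolutionHom P t s) (hf : resolutionHomD P t s f = 0) :
    resolutionHomPrecomp P P t (φ s) (hgr s) f - f ∈
      coboundaries (X := fun i => ↥(resolutionHom P t i)) (resolutionHomD P t) s := by
  obtain ⟨h, hh, h0, h1⟩ := P.exists_homotopy (fun i => φ i - LinearMap.id)
    (fun i p x hx => Submodule.sub_mem _ (hgr i p x hx) hx)
    (fun x => by simp [haug]) (fun i x => by simp [hd])
  have hf' : ∀ x, f.1 (P.d s x) = 0 := fun x => by rw [← resolutionHomD_apply, hf]; rfl
  cases s with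
  | zero =>
    refine Subtype.ext (LinearMap.ext fun x => ?_)
    change f.1 (φ 0 x) - f.1 x = 0
    rw [← map_sub]
    exact (congrArg f.1 (h0 x)).trans (hf' _)
  | succ s =>
    refine ⟨resolutionHomPrecomp P P t (h s) (hh s) f, Subtype.ext (LinearMap.ext fun x => ?_)⟩
    change f.1 (h s (P.d s x)) = f.1 (φ (s + 1) x) - f.1 x
    rw [← map_sub]
    refine Eq.trans ?_ (congrArg f.1 (h1 s x)).symm
    rw [map_add, hf', zero_add]

theorem nonempty_steenrodExt_equiv (hN : DirectSum.IsInternal 𝓝)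
    (P : GradedFreeResolution.{v, w} 𝓝) (P' : GradedFreeResolution.{v', w'} 𝓝) (s : ℕ) (t : ℤ) :
    Nonempty (SteenrodExt P s t ≃ₗ[ZMod 2] SteenrodExt P' s t) := by
  obtain ⟨φ, hφ, hφ0, hφd⟩ := GradedFreeResolution.exists_chainMap hN P P'
  obtain ⟨ψ, hψ, hψ0, hψd⟩ := GradedFreeResolution.exists_chainMap hN P' P
  refine nonempty_cohomology_equiv (X := fun i => ↥(resolutionHom P t i))
    (X' := fun i => ↥(resolutionHom P' t i)) _ _
    (fun i => resolutionHomPrecomp P' P t (ψ i) (hψ i)) (fun i f => ?_)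
    (fun i => resolutionHomPrecomp P P' t (φ i) (hφ i)) (fun i f => ?_) s (fun f hf => ?_)
    (fun f hf => ?_)
  · refine Subtype.ext (LinearMap.ext fun x => ?_)
    exact congrArg f.1 (hψd i x)
  · refine Subtype.ext (LinearMap.ext fun x => ?_)
    exact congrArg f.1 (hφd i x)
  · exact resolutionHom_homotopy P (fun i => ψ i ∘ₗ φ i)
      (fun i p x hx => hψ i p _ (hφ i p x hx)) (fun x => by simp [hφ0, hψ0])
      (fun i x => by simp [hφd, hψd]) t s f hf
  · exact resolutionHom_homotopy P' (fun i => φ i ∘ₗ ψ i)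
      (fun i p x hx => hφ i p _ (hψ i p x hx)) (fun x => by simp [hφ0, hψ0])
      (fun i x => by simp [hφd, hψd]) t s f hf

end Comparison

section ResolutionBasis

variable {N : Type*} [AddCommGroup N] [Module (ZMod 2) N] [Module SteenrodAlgebra N]
  {𝓝 : ℤ → Submodule (ZMod 2) N} (P : GradedFreeResolution.{v, w} 𝓝) (t : ℤ) (i : ℕ)

/-- The values of a map `P_i → 𝔽₂` on the generators of degree `t`. -/
def resolutionHomEval :
    resolutionHom P t i →ₗ[ZMod 2] ({j : P.idx i // P.deg i j = t} → ZMod 2) where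
  toFun f j := f.1 (P.gen i j)
  map_add' _ _ := rfl
  map_smul' _ _ := rfl

theorem resolutionHomEval_injective : Function.Injective (resolutionHomEval P t i) := by
  rw [injective_iff_map_eq_zero]
  intro f hf
  let g : P.obj i →ₗ[SteenrodAlgebra] ZMod 2 := { f.1 with map_smul' := f.2.1 }
  have hg : g = 0 := (P.gen i).ext fun j => by
    rcases eq_or_ne (P.deg i j) t with hj | hj
    · exact congrFun hf ⟨j, hj⟩
    · exact f.2.2 _ hj _ (P.gen_mem i j)
  exact Subtype.ext (LinearMap.ext fun x => LinearMap.congr_fun hg x)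

theorem resolutionHomEval_surjective : Function.Surjective (resolutionHomEval P t i) := by
  classical
  intro c
  let g : P.obj i →ₗ[SteenrodAlgebra] ZMod 2 :=
    (P.gen i).constr ℕ fun j => if h : P.deg i j = t then c ⟨j, h⟩ else 0
  have g_gen : ∀ j, g (P.gen i j) = if h : P.deg i j = t then c ⟨j, h⟩ else 0 :=
    (P.gen i).constr_basis ℕ _
  have g_mem := map_mem_of_generators (P.isGraded i) (isGradedSteenrodModule_concentrated t)
    (P.gen i).span_eq.ge (P.gen_mem i) g fun j => by
      rw [g_gen]
      split_ifs <;> trivial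
  refine ⟨⟨g.restrictScalars (ZMod 2), g.map_smul, fun p hp x hx => ?_⟩, ?_⟩
  · have := g_mem p x hx
    rwa [if_neg hp] at this
  · funext j
    exact (g_gen j).trans (dif_pos j.2)

/-- The basis of `Hom_𝒜^t(P_i, 𝔽₂)` dual to the generators of degree `t`. -/
def resolutionHomBasis [Finite {j : P.idx i // P.deg i j = t}] :
    Basis {j : P.idx i // P.deg i j = t} (ZMod 2) (resolutionHom P t i) :=
  Basis.ofEquivFun (LinearEquiv.ofBijective _
    ⟨resolutionHomEval_injective P t i, resolutionHomEval_surjective P t i⟩)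

theorem resolutionHomBasis_repr [Finite {j : P.idx i // P.deg i j = t}] (f : resolutionHom P t i)
    (j : {j : P.idx i // P.deg i j = t}) :
    (resolutionHomBasis P t i).repr f j = f.1 (P.gen i j) := rfl

end ResolutionBasis

/-! ### The resolution `N ⊗ F_*` -/

section TensorGrading

open DiagonalTensor

variable {N F : Type*} [AddCommGroup N] [Module (ZMod 2) N] [AddCommGroup F] [Module (ZMod 2) F]
  (𝓝 : ℤ → Submodule (ZMod 2) N) (𝓕 : ℤ → Submodule (ZMod 2) F)

/-- The total grading of `N ⊗ F`. -/
def tensorGrading (p : ℤ) : Submodule (ZMod 2) (DiagonalTensor N F) :=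
  ⨆ a, Submodule.map₂ tmul (𝓝 a) (𝓕 (p - a))

variable {𝓝 𝓕}

theorem tensorGrading_le {p : ℤ} {T : Submodule (ZMod 2) (DiagonalTensor N F)} :
    tensorGrading 𝓝 𝓕 p ≤ T ↔ ∀ a b, a + b = p → ∀ x ∈ 𝓝 a, ∀ y ∈ 𝓕 b, tmul x y ∈ T := by
  simp only [tensorGrading, iSup_le_iff, Submodule.map₂_le]
  constructor
  · rintro h a b rfl
    simpa using h a
  · exact fun h a => h a (p - a) (by omega)

theorem tmul_mem_tensorGrading {a b : ℤ} {x : N} {y : F} (hx : x ∈ 𝓝 a) (hy : y ∈ 𝓕 b) :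
    tmul x y ∈ tensorGrading 𝓝 𝓕 (a + b) :=
  tensorGrading_le.1 le_rfl a b rfl x hx y hy

theorem isInternal_tensorGrading {κ ι : Type*} (e : Basis κ (ZMod 2) N) {dim : κ → ℤ}
    (h𝓝 : DirectSum.IsInternal 𝓝) (he : ∀ k, e k ∈ 𝓝 (dim k)) (r : Basis ι (ZMod 2) F)
    {deg : ι → ℤ} (h𝓕 : DirectSum.IsInternal 𝓕) (hr : ∀ j, r j ∈ 𝓕 (deg j)) :
    DirectSum.IsInternal (tensorGrading 𝓝 𝓕) := by
  let b : Basis (κ × ι) (ZMod 2) (DiagonalTensor N F) :=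
    (e.tensorProduct r).map (DiagonalTensor.equiv N F).symm
  have b_apply : ∀ k, b k = tmul (e k.1) (r k.2) := fun k => by
    rw [Basis.map_apply, Basis.tensorProduct_apply']
    rfl
  have b_repr : ∀ x y k, b.repr (tmul x y) k = r.repr y k.2 • e.repr x k.1 := fun x y k =>
    Basis.tensorProduct_repr_tmul_apply e r x y k.1 k.2
  refine isInternal_of_basis b (fun k => dim k.1 + deg k.2) (fun k => ?_) fun p z hz k hk => ?_
  · rw [b_apply]
    exact tmul_mem_tensorGrading (he _) (hr _)
  · have hle : tensorGrading 𝓝 𝓕 p ≤ LinearMap.ker (b.coord k) := by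
      refine tensorGrading_le.2 fun a c hac x hx y hy => ?_
      rw [LinearMap.mem_ker, Basis.coord_apply, b_repr]
      rcases eq_or_ne (dim k.1) a with rfl | ha
      · rw [repr_eq_zero_of_mem r deg h𝓕 hr hy (by omega), zero_smul]
      · rw [repr_eq_zero_of_mem e dim h𝓝 he hx ha, smul_zero]
    exact hle hz

end TensorGrading

section TensorSteenrod

open DiagonalTensor Finset

variable {N F : Type*} [AddCommGroup N] [Module (ZMod 2) N] [Module SteenrodAlgebra N]
  [IsScalarTower (ZMod 2) SteenrodAlgebra N] [AddCommGroup F] [Module (ZMod 2) F]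
  [Module SteenrodAlgebra F] [IsScalarTower (ZMod 2) SteenrodAlgebra F]
  {𝓝 : ℤ → Submodule (ZMod 2) N} {𝓕 : ℤ → Submodule (ZMod 2) F}

theorem isGradedSteenrodModule_tensorGrading {κ : Type*} (e : Basis κ (ZMod 2) N) {dim : κ → ℤ}
    (h𝓝 : IsGradedSteenrodModule 𝓝) (he : ∀ k, e k ∈ 𝓝 (dim k))
    (h𝓕 : IsGradedSteenrodModule 𝓕) : IsGradedSteenrodModule (tensorGrading 𝓝 𝓕) where
  isInternal := by
    have b := fun p => Basis.ofVectorSpace (ZMod 2) (𝓕 p)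
    exact isInternal_tensorGrading e h𝓝.isInternal he (h𝓕.isInternal.collectedBasis b)
      h𝓕.isInternal (h𝓕.isInternal.collectedBasis_mem b)
  sq_smul_mem n p z hz := by
    suffices h : tensorGrading 𝓝 𝓕 p ≤ (tensorGrading 𝓝 𝓕 (p + n)).comap
        (Algebra.lsmul (ZMod 2) (ZMod 2) (DiagonalTensor N F) (Sq n)) from h hz
    refine tensorGrading_le.2 fun a b hab x hx y hy => ?_
    change Sq n • tmul x y ∈ tensorGrading 𝓝 𝓕 (p + n)
    rw [Sq_smul_tmul]
    refine sum_mem fun q hq => ?_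
    have := tmul_mem_tensorGrading (h𝓝.sq_smul_mem q.1 a x hx) (h𝓕.sq_smul_mem q.2 b y hy)
    have hq := mem_antidiagonal.1 hq
    rwa [show a + q.1 + (b + q.2) = p + n by omega] at this

namespace DiagonalTensor

variable (N)

/-- The map `1 ⊗ f` on the diagonal tensor products. -/
def lTensor {F' : Type*} [AddCommGroup F'] [Module (ZMod 2) F'] [Module SteenrodAlgebra F']
    [IsScalarTower (ZMod 2) SteenrodAlgebra F'] (f : F →ₗ[SteenrodAlgebra] F') :
    DiagonalTensor N F →ₗ[SteenrodAlgebra] DiagonalTensor N F' :=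
  steenrodLinear ((equiv N F').symm.toLinearMap ∘ₗ
    LinearMap.lTensor N (f.restrictScalars (ZMod 2)) ∘ₗ (equiv N F).toLinearMap) fun n z => by
      have lTensor_tmul : ∀ (x : N) (y : F), ((equiv N F').symm.toLinearMap ∘ₗ
          LinearMap.lTensor N (f.restrictScalars (ZMod 2)) ∘ₗ (equiv N F).toLinearMap) (tmul x y) =
          tmul x (f y) := fun _ _ => rfl
      induction z using DiagonalTensor.induction_on with
      | zero => rw [smul_zero, map_zero, smul_zero]
      | tmul x y => simp only [Sq_smul_tmul, map_sum, lTensor_tmul, map_smul]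
      | add z w hz hw => rw [smul_add, map_add, map_add, smul_add, hz, hw]

variable {F' F'' : Type*} [AddCommGroup F'] [Module (ZMod 2) F'] [Module SteenrodAlgebra F']
  [IsScalarTower (ZMod 2) SteenrodAlgebra F'] [AddCommGroup F''] [Module (ZMod 2) F'']
  [Module SteenrodAlgebra F''] [IsScalarTower (ZMod 2) SteenrodAlgebra F'']

theorem lTensor_tmul (f : F →ₗ[SteenrodAlgebra] F') (x : N) (y : F) :
    lTensor N f (tmul x y) = tmul x (f y) := rfl

theorem exact_lTensor {f : F →ₗ[SteenrodAlgebra] F'} {g : F' →ₗ[SteenrodAlgebra] F''}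
    (h : Function.Exact f g) : Function.Exact (lTensor N f) (lTensor N g) :=
  Module.Flat.lTensor_exact (R := ZMod 2) N (f := f.restrictScalars (ZMod 2))
    (g := g.restrictScalars (ZMod 2)) h

variable {N}

theorem lTensor_mem_tensorGrading {𝓕' : ℤ → Submodule (ZMod 2) F'}
    {f : F →ₗ[SteenrodAlgebra] F'} (hf : ∀ p, ∀ x ∈ 𝓕 p, f x ∈ 𝓕' p) {p : ℤ}
    {z : DiagonalTensor N F} (hz : z ∈ tensorGrading 𝓝 𝓕 p) :
    lTensor N f z ∈ tensorGrading 𝓝 𝓕' p := by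
  suffices h : tensorGrading 𝓝 𝓕 p ≤ (tensorGrading 𝓝 𝓕' p).comap
      ((lTensor N f).restrictScalars (ZMod 2)) from h hz
  refine tensorGrading_le.2 ?_
  rintro a b rfl x hx y hy
  exact tmul_mem_tensorGrading hx (hf b y hy)

variable (N)

/-- The isomorphism `N ⊗ 𝔽₂ ≃ N`. -/
def rid : DiagonalTensor N (ZMod 2) ≃ₗ[SteenrodAlgebra] N :=
  { (equiv N (ZMod 2)).trans (TensorProduct.rid (ZMod 2) N) with
    map_smul' := map_smul_of_map_Sq_smul
      ((TensorProduct.rid (ZMod 2) N).toLinearMap ∘ₗ (equiv N (ZMod 2)).toLinearMap) fun n z => by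
      have rid_tmul : ∀ (x : N) (c : ZMod 2), ((TensorProduct.rid (ZMod 2) N).toLinearMap ∘ₗ
          (equiv N (ZMod 2)).toLinearMap) (tmul x c) = c • x :=
        fun _ _ => TensorProduct.rid_tmul _ _
      induction z using DiagonalTensor.induction_on with
      | zero => rw [smul_zero, map_zero, smul_zero]
      | tmul x c =>
        rw [Sq_smul_tmul, map_sum, sum_eq_single (n, 0)]
        · rw [rid_tmul, rid_tmul, SteenrodAlgebra.Sq_zero, one_smul, smul_comm]
        · rintro ⟨i, j⟩ hij hne
          have hj : j ≠ 0 := by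
            rintro rfl
            exact hne (by simpa using hij)
          rw [rid_tmul, SteenrodAlgebra.smul_zmod, SteenrodAlgebra.augmentation_Sq, if_neg hj,
            zero_mul, zero_smul]
        · simp
      | add z w hz hw => rw [smul_add, map_add, map_add, smul_add, hz, hw] }

theorem rid_tmul (x : N) (c : ZMod 2) : rid N (tmul x c) = c • x :=
  TensorProduct.rid_tmul _ _

variable {N}

theorem rid_mem {p : ℤ} {z : DiagonalTensor N (ZMod 2)}
    (hz : z ∈ tensorGrading 𝓝 trivialGrading p) : rid N z ∈ 𝓝 p := by
  suffices h : tensorGrading 𝓝 trivialGrading p ≤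
      (𝓝 p).comap ((rid N).toLinearMap.restrictScalars (ZMod 2)) from h hz
  refine tensorGrading_le.2 ?_
  rintro a b rfl x hx c hc
  change rid N (tmul x c) ∈ 𝓝 (a + b)
  rw [rid_tmul]
  rcases eq_or_ne b 0 with rfl | hb
  · rw [add_zero]
    exact Submodule.smul_mem _ _ hx
  · rw [trivialGrading, if_neg hb, Submodule.mem_bot] at hc
    rw [hc, zero_smul]
    exact Submodule.zero_mem _

end DiagonalTensor

end TensorSteenrod

section TensorResolution

open DiagonalTensor

variable {N κ : Type*} [AddCommGroup N] [Module (ZMod 2) N] [Module SteenrodAlgebra N]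
  [IsScalarTower (ZMod 2) SteenrodAlgebra N] {𝓝 : ℤ → Submodule (ZMod 2) N}
  (h𝓝 : IsGradedSteenrodModule 𝓝) [LinearOrder κ] [WellFoundedGT κ] {e : Basis κ (ZMod 2) N}
  (hcell : IsCellular e) {dim : κ → ℤ} (he : ∀ k, e k ∈ 𝓝 (dim k))
  (F : GradedFreeResolution.{v, w} trivialGrading) (t : ℤ)

/-- The resolution `N ⊗ F_*` of `N`, for the diagonal action. -/
def tensorResolution : GradedFreeResolution 𝓝 where
  obj i := DiagonalTensor N (F.obj i)
  grading i := tensorGrading 𝓝 (F.grading i)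
  isGraded i := isGradedSteenrodModule_tensorGrading e h𝓝 he (F.isGraded i)
  idx i := κ ×ₗ F.idx i
  gen i := (DiagonalTensor.basis e hcell (F.gen i)).reindex toLex
  deg i p := dim (ofLex p).1 + F.deg i (ofLex p).2
  gen_mem i p := by
    rw [Basis.reindex_apply, basis_apply]
    exact tmul_mem_tensorGrading (he _) (F.gen_mem i _)
  d i := lTensor N (F.d i)
  aug := (rid N).toLinearMap ∘ₗ lTensor N F.aug
  d_mem i _ _ := lTensor_mem_tensorGrading (F.d_mem i)
  aug_mem _ _ hz := rid_mem (lTensor_mem_tensorGrading F.aug_mem hz)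
  exact i := exact_lTensor N (F.exact i)
  exact_zero z := (rid N).map_eq_zero_iff.trans (exact_lTensor N F.exact_zero z)
  aug_surjective x := by
    obtain ⟨y, hy⟩ := F.aug_surjective 1
    refine ⟨tmul x y, ?_⟩
    rw [LinearMap.comp_apply, lTensor_tmul, hy]
    exact (rid_tmul N x 1).trans (one_smul _ x)

/-- `Hom_𝒜^t(N ⊗ F_i, 𝔽₂)` in terms of the resolution `N ⊗ F_*`. -/
def diagonalHomEquiv (i : ℕ) :
    diagonalHom 𝓝 F t i ≃ₗ[ZMod 2] resolutionHom (tensorResolution h𝓝 hcell he F) t i where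
  toFun f := ⟨f.1, map_smul_of_map_Sq_smul
      (f.1 ∘ₗ (DiagonalTensor.equiv N (F.obj i)).toLinearMap) fun n z =>
        (congrArg f.1 (Sq_smul N (F.obj i) n z)).trans (f.2.1 n z),
    fun _ hp _ hx => (tensorGrading_le (T := LinearMap.ker f.1)).2
      (fun a b hab x hx y hy => f.2.2 a b (hab ▸ hp) x hx y hy) hx⟩
  invFun f := ⟨f.1, fun n z => (congrArg f.1 (Sq_smul N (F.obj i) n z)).symm.trans (f.2.1 (Sq n) z),
    fun p q hpq _ hx _ hy => f.2.2 (p + q) hpq _ (tmul_mem_tensorGrading hx hy)⟩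
  map_add' _ _ := rfl
  map_smul' _ _ := rfl

include h𝓝 hcell he in
theorem nonempty_steenrodExt_equiv_diagonalCohomology
    (P : GradedFreeResolution.{v', w'} 𝓝) (s : ℕ) :
    Nonempty (SteenrodExt P s t ≃ₗ[ZMod 2] DiagonalCohomology 𝓝 F t s) := by
  let Q := tensorResolution h𝓝 hcell he F
  obtain ⟨f⟩ := nonempty_steenrodExt_equiv h𝓝.isInternal P Q s t
  obtain ⟨g⟩ := nonempty_cohomology_equiv
    (X := fun i => ↥(resolutionHom Q t i)) (X' := fun i => ↥(diagonalHom 𝓝 F t i))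
    (resolutionHomD Q t) (diagonalHomD 𝓝 F t)
    (fun i => (diagonalHomEquiv h𝓝 hcell he F t i).symm.toLinearMap) (fun _ _ => rfl)
    (fun i => (diagonalHomEquiv h𝓝 hcell he F t i).toLinearMap) (fun _ _ => rfl) s
    (fun f _ => by simp) (fun f _ => by simp)
  exact ⟨f.trans g⟩

/-- The basis of the `e_k ⊗ r_{i,j}`. -/
def diagonalHomBasis [∀ i, Finite (TensorIndex dim F t i)] (i : ℕ) :
    Basis (TensorIndex dim F t i) (ZMod 2) (diagonalHom 𝓝 F t i) :=
  letI : Finite {j // (tensorResolution h𝓝 hcell he F).deg i j = t} :=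
    inferInstanceAs (Finite (TensorIndex dim F t i))
  (resolutionHomBasis (tensorResolution h𝓝 hcell he F) t i).map
    (diagonalHomEquiv h𝓝 hcell he F t i).symm

theorem diagonalHomBasis_repr [∀ i, Finite (TensorIndex dim F t i)] (i : ℕ)
    (f : diagonalHom 𝓝 F t i) (x : TensorIndex dim F t i) :
    (diagonalHomBasis h𝓝 hcell he F t i).repr f x =
      f.1 (e (ofLex x.1).1 ⊗ₜ F.gen i (ofLex x.1).2) := by
  have : Finite {j // (tensorResolution h𝓝 hcell he F).deg i j = t} :=
    inferInstanceAs (Finite (TensorIndex dim F t i))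
  have hgen : (DiagonalTensor.basis e hcell (F.gen i)).reindex toLex x.1 =
      tmul (e (ofLex x.1).1) (F.gen i (ofLex x.1).2) :=
    (Basis.reindex_apply _ _ _).trans (basis_apply e hcell (F.gen i) _)
  exact (resolutionHomBasis_repr (tensorResolution h𝓝 hcell he F) t i
    (diagonalHomEquiv h𝓝 hcell he F t i f) x).trans (congrArg f.1 hgen)

theorem isDualBasis_diagonalHomBasis [∀ i, Finite (TensorIndex dim F t i)] :
    IsDualBasis e dim (diagonalHomBasis h𝓝 hcell he F t) := by
  classical
  intro i x k j
  have repr_self : ∀ y, (diagonalHomBasis h𝓝 hcell he F t i x).1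
      (e (ofLex y.1).1 ⊗ₜ F.gen i (ofLex y.1).2) = if x = y then 1 else 0 := fun y => by
    rw [← diagonalHomBasis_repr h𝓝 hcell he, Basis.repr_self, Finsupp.single_apply]
  constructor
  · intro hx
    simpa [hx] using repr_self x
  · intro hx
    by_cases ht : dim k + F.deg i j = t
    · exact (repr_self ⟨toLex (k, j), ht⟩).trans (if_neg fun h => hx (congrArg Subtype.val h))
    · exact (diagonalHomBasis h𝓝 hcell he F t i x).2.2 _ _ ht _ (he k) _ (F.gen_mem i j)

end TensorResolution

theorem finite_tensorIndex {L κ : Type*} [AddCommGroup L] [Module (ZMod 2) L]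
    [Module SteenrodAlgebra L] {𝓛 : ℤ → Submodule (ZMod 2) L} [Finite κ] (dim : κ → ℤ)
    (F : GradedFreeResolution.{v, w} 𝓛)
    (hF : ∀ (i : ℕ) (q : ℤ), {j : F.idx i | F.deg i j = q}.Finite) (t : ℤ) (i : ℕ) :
    Finite (TensorIndex dim F t i) := by
  have : ∀ k, Finite {j : F.idx i // F.deg i j = t - dim k} := fun k => hF i _
  refine Finite.of_surjective (α := Σ k : κ, {j : F.idx i // F.deg i j = t - dim k})
    (fun p => ⟨toLex (p.1, p.2.1), ?_⟩) fun x => ⟨⟨(ofLex x.1).1, (ofLex x.1).2, ?_⟩, rfl⟩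
  · have := p.2.2
    simp only [ofLex_toLex]
    omega
  · have := x.2
    omega

/-! ### Leading terms -/

section LeadingTerm

variable {ι V : Type*} [LinearOrder ι] [AddCommGroup V] [Module (ZMod 2) V]
  {b : Basis ι (ZMod 2) V} {v w : V} {j k : ι}

theorem exists_isLeadingTerm (b : Basis ι (ZMod 2) V) (hv : v ≠ 0) : ∃ j, IsLeadingTerm b v j := by
  have hne : (b.repr v).support.Nonempty := by simpa using hv
  exact ⟨(b.repr v).support.max' hne, Finsupp.mem_support_iff.1 (Finset.max'_mem _ _),
    fun k hk => Finset.le_max' _ _ (Finsupp.mem_support_iff.2 hk)⟩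

theorem isLeadingTerm_basis_self (b : Basis ι (ZMod 2) V) (j : ι) : IsLeadingTerm b (b j) j := by
  refine ⟨by simp, fun k hk => le_of_eq ?_⟩
  contrapose! hk
  rw [b.repr_self, Finsupp.single_eq_of_ne hk]

namespace IsLeadingTerm

theorem ne_zero (hj : IsLeadingTerm b v j) : v ≠ 0 := by
  rintro rfl
  exact hj.1 (by simp)

theorem repr_eq_zero (hj : IsLeadingTerm b v j) (hjk : j < k) : b.repr v k = 0 :=
  not_not.1 fun h => hjk.not_ge (hj.2 k h)

theorem repr_eq_one (hj : IsLeadingTerm b v j) : b.repr v j = 1 :=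
  Fin.eq_one_of_ne_zero _ hj.1

theorem lt_of_add (hv : IsLeadingTerm b v j) (hw : IsLeadingTerm b w j)
    (hk : IsLeadingTerm b (v + w) k) : k < j := by
  have hsum : b.repr v k + b.repr w k ≠ 0 := by simpa using hk.1
  contrapose! hsum
  obtain rfl | hlt := hsum.eq_or_lt
  · rw [hv.repr_eq_one, hw.repr_eq_one]
    rfl
  · rw [hv.repr_eq_zero hlt, hw.repr_eq_zero hlt, add_zero]

theorem add_of_lt (hv : IsLeadingTerm b v j) (hw : IsLeadingTerm b w k) (hkj : k < j) :
    IsLeadingTerm b (v + w) j := by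
  refine ⟨?_, fun l hl => ?_⟩
  · rw [map_add, Finsupp.add_apply, hw.repr_eq_zero hkj, add_zero]
    exact hv.1
  · contrapose! hl
    rw [map_add, Finsupp.add_apply, hv.repr_eq_zero hl, hw.repr_eq_zero (hkj.trans hl), add_zero]

theorem add_of_gt (hv : IsLeadingTerm b v j) (hw : IsLeadingTerm b w k) (hjk : j < k) :
    IsLeadingTerm b (v + w) k := by
  rw [add_comm]
  exact hw.add_of_lt hv hjk

theorem exists_of_map {κ W : Type*} [LinearOrder κ] [AddCommGroup W] [Module (ZMod 2) W]
    {c : Basis κ (ZMod 2) W} {f : V →ₗ[ZMod 2] W} {y : κ} (b : Basis ι (ZMod 2) V)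
    (hy : IsLeadingTerm c (f v) y) : ∃ x, IsLeadingTerm b v x :=
  exists_isLeadingTerm b fun hv => hy.ne_zero (by rw [hv, map_zero])

end IsLeadingTerm

theorem isLeadingTerm_linearCombination {S : ι → Prop} {z : {x // S x} → V}
    (hz : ∀ x, IsLeadingTerm b (z x) x.1) {l : {x // S x} →₀ ZMod 2} (hl : l ≠ 0) :
    ∃ x : {x // S x}, IsLeadingTerm b (Finsupp.linearCombination (ZMod 2) z l) x.1 := by
  have hne : l.support.Nonempty := Finsupp.support_nonempty_iff.2 hl
  have hle_max : ∀ x ∈ l.support, x ≤ l.support.max' hne := fun x hx => Finset.le_max' _ _ hx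
  have hmem := Finset.max'_mem _ hne
  set y := l.support.max' hne
  have hrepr (k : ι) : b.repr (Finsupp.linearCombination (ZMod 2) z l) k =
      ∑ x ∈ l.support, l x * b.repr (z x) k := by
    simp [Finsupp.linearCombination_apply, Finsupp.sum, Finsupp.finsetSum_apply]
  refine ⟨y, ?_, fun k hk => ?_⟩
  · rw [hrepr, Finset.sum_eq_single_of_mem y hmem]
    · exact mul_ne_zero (Finsupp.mem_support_iff.1 hmem) (hz y).1
    · intro x hx hxy
      rw [(hz x).repr_eq_zero ((hle_max x hx).lt_of_ne hxy), mul_zero]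
  · rw [hrepr] at hk
    obtain ⟨x, hx, hxk⟩ := Finset.exists_ne_zero_of_sum_ne_zero hk
    exact ((hz x).2 k (right_ne_zero_of_mul hxk)).trans (hle_max x hx)

/-- The leading terms of the vectors of a subspace. -/
def leadingTerms (b : Basis ι (ZMod 2) V) (Z : Submodule (ZMod 2) V) : Set ι :=
  {x | ∃ v ∈ Z, IsLeadingTerm b v x}

variable {Z Z' : Submodule (ZMod 2) V}

theorem leadingTerms_mono (b : Basis ι (ZMod 2) V) (h : Z ≤ Z') :
    leadingTerms b Z ⊆ leadingTerms b Z' :=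
  fun _ ⟨v, hv, hx⟩ => ⟨v, h hv, hx⟩

theorem leadingTerms_bot (b : Basis ι (ZMod 2) V) : leadingTerms b ⊥ = ∅ :=
  Set.eq_empty_of_forall_notMem fun _ ⟨_, hv, hx⟩ => hx.ne_zero hv

theorem eq_of_le_of_leadingTerms_subset [WellFoundedLT ι] (hle : Z' ≤ Z)
    (h : leadingTerms b Z ⊆ leadingTerms b Z') : Z' = Z := by
  have hmem : ∀ x, ∀ v ∈ Z, IsLeadingTerm b v x → v ∈ Z' := by
    intro x
    induction x using WellFoundedLT.induction with
    | ind x ih =>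
      intro v hv hx
      obtain ⟨w, hw, hwx⟩ := h ⟨v, hv, hx⟩
      refine (Submodule.add_mem_iff_left _ hw).1 ?_
      by_cases h0 : v + w = 0
      · exact h0 ▸ Z'.zero_mem
      · obtain ⟨y, hy⟩ := exists_isLeadingTerm b h0
        exact ih y (hx.lt_of_add hwx hy) _ (Z.add_mem hv (hle hw)) hy
  refine hle.antisymm fun v hv => ?_
  by_cases h0 : v = 0
  · exact h0 ▸ Z'.zero_mem
  · obtain ⟨x, hx⟩ := exists_isLeadingTerm b h0
    exact hmem x v hv hx

section Quotient

variable {S : ι → Prop} {z : {x // S x} → Z}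

theorem linearIndependent_mkQ_of_isLeadingTerm (hS : ∀ x, S x → x ∉ leadingTerms b Z')
    (hz : ∀ x, IsLeadingTerm b (z x : V) x) :
    LinearIndependent (ZMod 2) ((Z'.submoduleOf Z).mkQ ∘ z) := by
  rw [linearIndependent_iff]
  intro l hl
  by_contra hne
  obtain ⟨x, hx⟩ := isLeadingTerm_linearCombination hz hne
  refine hS x x.2 ⟨_, ?_, hx⟩
  rw [← Finsupp.apply_linearCombination, Submodule.mkQ_apply, Submodule.Quotient.mk_eq_zero] at hl
  have hmem : Z.subtype (Finsupp.linearCombination (ZMod 2) z l) ∈ Z' := hl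
  rwa [Finsupp.apply_linearCombination] at hmem

theorem span_mkQ_eq_top_of_isLeadingTerm [WellFoundedLT ι] (hle : Z' ≤ Z)
    (hS : ∀ x ∈ leadingTerms b Z, x ∉ leadingTerms b Z' → S x)
    (hz : ∀ x, IsLeadingTerm b (z x : V) x) :
    Submodule.span (ZMod 2) (Set.range ((Z'.submoduleOf Z).mkQ ∘ z)) = ⊤ := by
  set U := Z' ⊔ Submodule.span (ZMod 2) (Set.range fun x => (z x : V))
  have hUZ : U ≤ Z := sup_le hle (Submodule.span_le.2 (by rintro _ ⟨x, rfl⟩; exact (z x).2))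
  have hU : U = Z := by
    refine eq_of_le_of_leadingTerms_subset (b := b) hUZ fun x hx => ?_
    by_cases hx' : x ∈ leadingTerms b Z'
    · exact leadingTerms_mono b le_sup_left hx'
    · exact ⟨_, Submodule.mem_sup_right (Submodule.subset_span ⟨⟨x, hS x hx hx'⟩, rfl⟩), hz _⟩
  rw [Set.range_comp, Submodule.span_image, eq_top_iff]
  rintro y -
  obtain ⟨v, rfl⟩ := Submodule.mkQ_surjective _ y
  obtain ⟨v', hv', w, hw, hv⟩ := Submodule.mem_sup.1 (hU.ge v.2)
  rw [show (fun x => (z x : V)) = Z.subtype ∘ z from rfl, Set.range_comp, Submodule.span_image]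
    at hw
  obtain ⟨w, hw, rfl⟩ := hw
  refine ⟨w, hw, (Submodule.Quotient.eq' _).2 ?_⟩
  have hv'' : -w + v = (⟨v', hle hv'⟩ : Z) := Subtype.ext (by simp [← hv])
  rw [hv'']
  exact hv'

theorem exists_basis_quotient_of_isLeadingTerm [WellFoundedLT ι] (hle : Z' ≤ Z)
    (hS : ∀ x, S x ↔ x ∈ leadingTerms b Z \ leadingTerms b Z')
    (hz : ∀ x, IsLeadingTerm b (z x : V) x) :
    ∃ B : Basis {x // S x} (ZMod 2) (Z ⧸ Z'.submoduleOf Z),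
      ∀ x, B x = (Z'.submoduleOf Z).mkQ (z x) :=
  ⟨Basis.mk (linearIndependent_mkQ_of_isLeadingTerm (fun x hx => ((hS x).1 hx).2) hz)
    (span_mkQ_eq_top_of_isLeadingTerm hle (fun x hx hx' => (hS x).2 ⟨hx, hx'⟩) hz).ge,
    fun x => Basis.mk_apply _ _ x⟩

end Quotient

end LeadingTerm

section Tag

variable {ι κ V W : Type*} [LinearOrder ι] [LinearOrder κ] [AddCommGroup V] [Module (ZMod 2) V]
  [AddCommGroup W] [Module (ZMod 2) W]

/-- `f` maps some vector with leading term `x` to a vector with leading term `y`. -/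
def LeadsTo (f : V →ₗ[ZMod 2] W) (b : Basis ι (ZMod 2) V) (c : Basis κ (ZMod 2) W) (y : κ)
    (x : ι) : Prop :=
  ∃ v, IsLeadingTerm b v x ∧ IsLeadingTerm c (f v) y

/-- The tags `y ← x` of a linear map `f`: `x` is the least leading term of the vectors that `f` maps
to vectors with leading term `y`. They turn out to be the tags of the Curtis table. -/
def IsTag (f : V →ₗ[ZMod 2] W) (b : Basis ι (ZMod 2) V) (c : Basis κ (ZMod 2) W) (y : κ)
    (x : ι) : Prop :=
  IsLeast {x' | LeadsTo f b c y x'} x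

variable {f : V →ₗ[ZMod 2] W} {b : Basis ι (ZMod 2) V} {c : Basis κ (ZMod 2) W}

theorem LeadsTo.mem_leadingTerms_range {y : κ} {x : ι} (h : LeadsTo f b c y x) :
    y ∈ leadingTerms c f.range :=
  let ⟨v, _, hy⟩ := h
  ⟨f v, ⟨v, rfl⟩, hy⟩

theorem exists_isTag_of_mem_leadingTerms_range [WellFoundedLT ι] {y : κ}
    (hy : y ∈ leadingTerms c f.range) : ∃ x, IsTag f b c y x := by
  have hne : {x | LeadsTo f b c y x}.Nonempty := by
    obtain ⟨_, ⟨v, rfl⟩, hv⟩ := hy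
    obtain ⟨x, hx⟩ := hv.exists_of_map b
    exact ⟨x, v, hx, hv⟩
  obtain ⟨x, hx, hmin⟩ := wellFounded_lt.has_min _ hne
  exact ⟨x, hx, fun x' hx' => not_lt.1 (hmin x' hx')⟩

/-- The tag of `x` is found by making the leading term of `f v` as small as possible. -/
theorem exists_isTag_of_notMem_leadingTerms_ker [WellFoundedLT κ] {x : ι}
    (hx : x ∉ leadingTerms b f.ker) : ∃ y, IsTag f b c y x := by
  have hmap {v : V} (hv : IsLeadingTerm b v x) : ∃ y, IsLeadingTerm c (f v) y :=
    exists_isLeadingTerm c fun h => hx ⟨v, h, hv⟩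
  have hne : {y | LeadsTo f b c y x}.Nonempty :=
    (hmap (isLeadingTerm_basis_self b x)).imp fun y hy => ⟨_, isLeadingTerm_basis_self b x, hy⟩
  obtain ⟨y, ⟨v, hv, hy⟩, hmin⟩ := wellFounded_lt.has_min _ hne
  refine ⟨y, ⟨v, hv, hy⟩, fun x' ⟨w, hw, hwy⟩ => ?_⟩
  by_contra! hlt
  have hvw := hv.add_of_lt hw hlt
  obtain ⟨y', hy'⟩ := hmap hvw
  refine hmin y' ⟨_, hvw, hy'⟩ ?_
  rw [map_add] at hy'
  exact hy.lt_of_add hwy hy'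

namespace IsTag

variable {y y' : κ} {x : ι}

theorem notMem_leadingTerms_ker (h : IsTag f b c y x) : x ∉ leadingTerms b f.ker := by
  rintro ⟨z, hz, hzx⟩
  obtain ⟨⟨v, hv, hy⟩, hmin⟩ := h
  have hf : IsLeadingTerm c (f (v + z)) y := by rwa [map_add, LinearMap.mem_ker.1 hz, add_zero]
  obtain ⟨x', hx'⟩ := hf.exists_of_map b
  exact (hv.lt_of_add hzx hx').not_ge (hmin ⟨_, hx', hf⟩)

theorem le_left (h : IsTag f b c y x) (h' : LeadsTo f b c y' x) : y ≤ y' := by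
  by_contra! hlt
  obtain ⟨⟨v, hv, hy⟩, hmin⟩ := h
  obtain ⟨v', hv', hy'⟩ := h'
  have hf : IsLeadingTerm c (f (v + v')) y := by
    rw [map_add]
    exact hy.add_of_lt hy' hlt
  obtain ⟨x', hx'⟩ := hf.exists_of_map b
  exact (hv.lt_of_add hv' hx').not_ge (hmin ⟨_, hx', hf⟩)

theorem left_unique (h : IsTag f b c y x) (h' : IsTag f b c y' x) : y = y' :=
  le_antisymm (h.le_left h'.1) (h'.le_left h.1)

end IsTag

end Tag

/-! ### Curtis tables -/

section CurtisTable

variable {ι : ℕ → Type*} [∀ i, LinearOrder (ι i)] {X : ℕ → Type*} [∀ i, AddCommGroup (X i)]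
  [∀ i, Module (ZMod 2) (X i)] (δ : ∀ i, X i →ₗ[ZMod 2] X (i + 1))
  (B : ∀ i, Basis (ι i) (ZMod 2) (X i))

/-- The leading terms of cocycles that do not lead a coboundary: the untagged items of the Curtis
table. -/
def cohomologyLeadingTerms (i : ℕ) : Set (ι i) :=
  leadingTerms (B i) (cocycles δ i) \ leadingTerms (B i) (coboundaries δ i)

/-- The items of the Curtis table. -/
def IsCurtisItem : ∀ {i : ℕ}, CurtisItem ι i → Prop
  | i, .single x => x ∈ cohomologyLeadingTerms δ B i
  | _, .tag (i := i) a b => IsTag (δ i) (B i) (B (i + 1)) a b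

/-- The Curtis table of a complex whose bases are well-ordered. -/
def curtisTable (i : ℕ) : Set (CurtisItem ι i) := {q | IsCurtisItem δ B q}

variable {δ B}

omit [∀ i, LinearOrder (ι i)] in
theorem coboundaries_le_cocycles (hδ : ∀ i x, δ (i + 1) (δ i x) = 0) (i : ℕ) :
    coboundaries δ i ≤ cocycles δ i := by
  cases i with
  | zero => exact bot_le
  | succ i =>
    rintro _ ⟨w, rfl⟩
    exact hδ i w

theorem leadingTerms_coboundaries_zero : leadingTerms (B 0) (coboundaries δ 0) = ∅ :=
  leadingTerms_bot (B 0)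

section CurtisItem

variable [∀ i, WellFoundedLT (ι i)] (hδ : ∀ i x, δ (i + 1) (δ i x) = 0) {i : ℕ} {x : ι i}
include hδ

theorem existsUnique_curtisItem_of_mem_coboundaries
    (hx : x ∈ leadingTerms (B i) (coboundaries δ i)) :
    ∃! q : Σ i, CurtisItem ι i, q.2 ∈ curtisTable δ B q.1 ∧ q.2.Mentions ⟨i, x⟩ := by
  have hcocycle := leadingTerms_mono (B i) (coboundaries_le_cocycles hδ i) hx
  cases i with
  | zero => simp [leadingTerms_coboundaries_zero] at hx
  | succ i =>
    obtain ⟨b, hb⟩ := exists_isTag_of_mem_leadingTerms_range (b := B i) hx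
    refine ⟨⟨i + 1, .tag x b⟩, ⟨hb, Or.inl rfl⟩, ?_⟩
    rintro ⟨_, x' | ⟨a, b'⟩⟩ ⟨hq, hm⟩
    · cases hm
      exact absurd hx hq.2
    · rcases hm with hm | hm
      · cases hm
        rw [IsLeast.unique hb hq]
      · cases hm
        exact absurd hcocycle (IsTag.notMem_leadingTerms_ker hq)

omit [∀ i, WellFoundedLT (ι i)] hδ in
theorem existsUnique_curtisItem_of_mem_cohomologyLeadingTerms
    (hx : x ∈ cohomologyLeadingTerms δ B i) :
    ∃! q : Σ i, CurtisItem ι i, q.2 ∈ curtisTable δ B q.1 ∧ q.2.Mentions ⟨i, x⟩ := by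
  refine ⟨⟨i, .single x⟩, ⟨hx, rfl⟩, ?_⟩
  rintro ⟨_, x' | ⟨a, b⟩⟩ ⟨hq, hm⟩
  · cases hm
    rfl
  · rcases hm with hm | hm
    · cases hm
      exact absurd (LeadsTo.mem_leadingTerms_range hq.1) hx.2
    · cases hm
      exact absurd hx.1 (IsTag.notMem_leadingTerms_ker hq)

theorem existsUnique_curtisItem_of_notMem_cocycles
    (hx : x ∉ leadingTerms (B i) (cocycles δ i)) :
    ∃! q : Σ i, CurtisItem ι i, q.2 ∈ curtisTable δ B q.1 ∧ q.2.Mentions ⟨i, x⟩ := by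
  obtain ⟨a, ha⟩ := exists_isTag_of_notMem_leadingTerms_ker (c := B (i + 1)) hx
  refine ⟨⟨i + 1, .tag a x⟩, ⟨ha, Or.inr rfl⟩, ?_⟩
  rintro ⟨_, x' | ⟨a', b⟩⟩ ⟨hq, hm⟩
  · cases hm
    exact absurd hq.1 hx
  · rcases hm with hm | hm
    · cases hm
      exact absurd (leadingTerms_mono _ (coboundaries_le_cocycles hδ _)
        (LeadsTo.mem_leadingTerms_range hq.1)) hx
    · cases hm
      rw [IsTag.left_unique ha hq]

end CurtisItem

theorem isCurtisTable_curtisTable [∀ i, WellFoundedLT (ι i)]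
    (hδ : ∀ i x, δ (i + 1) (δ i x) = 0) : IsCurtisTable δ B (curtisTable δ B) where
  appears_once := by
    rintro ⟨i, x⟩
    by_cases hx : x ∈ leadingTerms (B i) (cocycles δ i)
    · by_cases hx' : x ∈ leadingTerms (B i) (coboundaries δ i)
      · exact existsUnique_curtisItem_of_mem_coboundaries hδ hx'
      · exact existsUnique_curtisItem_of_mem_cohomologyLeadingTerms ⟨hx, hx'⟩
    · exact existsUnique_curtisItem_of_notMem_cocycles hδ hx
  single_or_head_iff_zero x :=
    ⟨fun h => h.1, fun h => ⟨h, by simp [leadingTerms_coboundaries_zero]⟩⟩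
  single_or_head_iff_succ i x := by
    constructor
    · rintro (h | ⟨b, hb⟩)
      · exact h.1
      · exact leadingTerms_mono _ (coboundaries_le_cocycles hδ (i + 1))
          (LeadsTo.mem_leadingTerms_range hb.1)
    · intro h
      by_cases h' : x ∈ leadingTerms (B (i + 1)) (coboundaries δ (i + 1))
      · exact Or.inr (exists_isTag_of_mem_leadingTerms_range h')
      · exact Or.inl ⟨h, h'⟩
  tag_boundary _ _ _ h := h.1

namespace IsCurtisTable

variable {L : ∀ i, Set (CurtisItem ι i)}

theorem eq_of_mentions (hL : IsCurtisTable δ B L) {i j k : ℕ} {p : CurtisItem ι i}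
    {q : CurtisItem ι j} (y : ι k) (hp : p ∈ L i) (hq : q ∈ L j) (hpy : p.Mentions ⟨k, y⟩)
    (hqy : q.Mentions ⟨k, y⟩) : (⟨i, p⟩ : Σ i, CurtisItem ι i) = ⟨j, q⟩ :=
  (hL.appears_once ⟨k, y⟩).unique ⟨hp, hpy⟩ ⟨hq, hqy⟩

theorem mem_cocycles_of_single (hL : IsCurtisTable δ B L) {i : ℕ} {x : ι i}
    (h : CurtisItem.single x ∈ L i) : x ∈ leadingTerms (B i) (cocycles δ i) := by
  cases i with
  | zero => exact (hL.single_or_head_iff_zero x).1 h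
  | succ i => exact (hL.single_or_head_iff_succ i x).1 (Or.inl h)

theorem exists_tag_of_notMem_cocycles (hL : IsCurtisTable δ B L) {i : ℕ} {b : ι i}
    (h : b ∉ leadingTerms (B i) (cocycles δ i)) : ∃ a, CurtisItem.tag a b ∈ L (i + 1) := by
  obtain ⟨⟨j, x | ⟨a, c⟩⟩, ⟨hq, hm⟩, -⟩ := hL.appears_once ⟨i, b⟩
  · cases hm
    exact absurd (hL.mem_cocycles_of_single hq) h
  · rcases hm with hm | hm
    · cases hm
      exact absurd ((hL.single_or_head_iff_succ _ _).1 (Or.inr ⟨c, hq⟩)) h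
    · cases hm
      exact ⟨a, hq⟩

theorem tag_right_unique (hL : IsCurtisTable δ B L) {i : ℕ} {a : ι (i + 1)} {b b' : ι i}
    (h : CurtisItem.tag a b ∈ L (i + 1)) (h' : CurtisItem.tag a b' ∈ L (i + 1)) : b = b' := by
  cases hL.eq_of_mentions a h h' (Or.inl rfl) (Or.inl rfl)
  rfl

theorem exists_tag_le_of_leadsTo [∀ i, WellFoundedLT (ι i)] (hL : IsCurtisTable δ B L) {i : ℕ}
    {a : ι (i + 1)} {b : ι i} (h : LeadsTo (δ i) (B i) (B (i + 1)) a b) :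
    ∃ b' ≤ b, CurtisItem.tag a b' ∈ L (i + 1) := by
  induction b using WellFoundedLT.induction generalizing a with
  | ind b ih =>
  obtain ⟨w, hwb, hwa⟩ := h
  have descend {v : X i} (hv : IsLeadingTerm (B i) v b) {a' : ι (i + 1)}
      (ha' : IsLeadingTerm (B (i + 1)) (δ i (w + v)) a') :
      ∃ b' < b, CurtisItem.tag a' b' ∈ L (i + 1) := by
    obtain ⟨b', hb'⟩ := ha'.exists_of_map (B i)
    have hlt := hwb.lt_of_add hv hb'
    obtain ⟨b'', hle, h⟩ := ih b' hlt ⟨_, hb', ha'⟩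
    exact ⟨b'', hle.trans_lt hlt, h⟩
  by_cases hb : b ∈ leadingTerms (B i) (cocycles δ i)
  · obtain ⟨z, hz, hzb⟩ := hb
    obtain ⟨b', hlt, h⟩ := descend hzb (by rwa [map_add, LinearMap.mem_ker.1 hz, add_zero])
    exact ⟨b', hlt.le, h⟩
  · obtain ⟨a', htag⟩ := hL.exists_tag_of_notMem_cocycles hb
    obtain ⟨v, hvb, hva'⟩ := hL.tag_boundary i a' b htag
    rcases lt_trichotomy a a' with hlt | rfl | hlt
    · obtain ⟨b', hb', h⟩ := descend hvb (by rw [map_add]; exact hwa.add_of_gt hva' hlt)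
      exact absurd (hL.tag_right_unique h htag) hb'.ne
    · exact ⟨b, le_rfl, htag⟩
    · obtain ⟨b', hb', h⟩ := descend hvb (by rw [map_add]; exact hwa.add_of_lt hva' hlt)
      exact ⟨b', hb'.le, h⟩

theorem tag_iff [∀ i, WellFoundedLT (ι i)] (hL : IsCurtisTable δ B L) {i : ℕ} (a : ι (i + 1))
    (b : ι i) : CurtisItem.tag a b ∈ L (i + 1) ↔ IsTag (δ i) (B i) (B (i + 1)) a b := by
  have isTag {a} (h : CurtisItem.tag a b ∈ L (i + 1)) : IsTag (δ i) (B i) (B (i + 1)) a b := by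
    refine ⟨hL.tag_boundary i a b h, fun b' hb' => ?_⟩
    obtain ⟨b'', hle, h'⟩ := hL.exists_tag_le_of_leadsTo hb'
    rwa [hL.tag_right_unique h h']
  refine ⟨isTag, fun h => ?_⟩
  obtain ⟨a', ha'⟩ := hL.exists_tag_of_notMem_cocycles h.notMem_leadingTerms_ker
  rwa [h.left_unique (isTag ha')]

theorem single_iff [∀ i, WellFoundedLT (ι i)] (hL : IsCurtisTable δ B L) {i : ℕ} (x : ι i) :
    CurtisItem.single x ∈ L i ↔ x ∈ cohomologyLeadingTerms δ B i := by
  cases i with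
  | zero =>
    rw [hL.single_or_head_iff_zero, cohomologyLeadingTerms, leadingTerms_coboundaries_zero,
      Set.sdiff_empty]
    rfl
  | succ i =>
    constructor
    · refine fun h => ⟨hL.mem_cocycles_of_single h, fun hx => ?_⟩
      obtain ⟨b, hb⟩ := exists_isTag_of_mem_leadingTerms_range (b := B i) hx
      cases hL.eq_of_mentions x h ((hL.tag_iff x b).2 hb) rfl (Or.inl rfl)
    · rintro ⟨h, h'⟩
      rcases (hL.single_or_head_iff_succ i x).2 h with h | ⟨b, hb⟩
      · exact h
      · exact absurd (LeadsTo.mem_leadingTerms_range (hL.tag_boundary i x b hb)) h'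

theorem eq_curtisTable [∀ i, WellFoundedLT (ι i)] (hL : IsCurtisTable δ B L) :
    L = curtisTable δ B := by
  ext i q
  cases q with
  | single x => exact hL.single_iff x
  | tag a b => exact hL.tag_iff a b

theorem single_iff_not_mentions (hL : IsCurtisTable δ B L) {s : ℕ} (x : ι s) :
    CurtisItem.single x ∈ L s ↔ ¬ ∃ (i : ℕ) (a : ι (i + 1)) (b : ι i),
      CurtisItem.tag a b ∈ L (i + 1) ∧ (CurtisItem.tag a b).Mentions ⟨s, x⟩ := by
  constructor
  · rintro h ⟨i, a, b, hab, hm⟩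
    cases hL.eq_of_mentions x h hab rfl hm
  · intro h
    obtain ⟨⟨j, x | ⟨a, b⟩⟩, ⟨hq, hm⟩, -⟩ := hL.appears_once ⟨s, x⟩
    · cases hm
      exact hq
    · exact absurd ⟨_, a, b, hq, hm⟩ h

end IsCurtisTable

theorem existsUnique_isCurtisTable [∀ i, WellFoundedLT (ι i)]
    (hδ : ∀ i x, δ (i + 1) (δ i x) = 0) : ∃! L, IsCurtisTable δ B L :=
  ⟨_, isCurtisTable_curtisTable hδ, fun _ hL => hL.eq_curtisTable⟩

theorem exists_basis_cohomology {s : ℕ} [WellFoundedLT (ι s)]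
    (hδ : ∀ i x, δ (i + 1) (δ i x) = 0) {S : ι s → Prop}
    (hS : ∀ x, S x ↔ x ∈ cohomologyLeadingTerms δ B s) (z : {x // S x} → cocycles δ s)
    (hz : ∀ x, IsLeadingTerm (B s) (z x).1 x.1) :
    ∃ b : Basis {x // S x} (ZMod 2) (Cohomology δ s), ∀ x, b x = cohomologyClass δ s (z x) :=
  exists_basis_quotient_of_isLeadingTerm (coboundaries_le_cocycles hδ s) hS hz

theorem nonempty_cohomology_equiv_finsupp {s : ℕ} [WellFoundedLT (ι s)]
    (hδ : ∀ i x, δ (i + 1) (δ i x) = 0) {S : ι s → Prop}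
    (hS : ∀ x, S x ↔ x ∈ cohomologyLeadingTerms δ B s) :
    Nonempty (Cohomology δ s ≃ₗ[ZMod 2] ({x // S x} →₀ ZMod 2)) := by
  choose z hz using fun x : {x // S x} => ((hS x).1 x.2).1
  obtain ⟨b, -⟩ := exists_basis_cohomology hδ hS (fun x => ⟨z x, (hz x).1⟩) fun x => (hz x).2
  exact ⟨b.repr⟩

end CurtisTable

/-! ### Truncation -/

section TruncatesTo

variable {ι ι' V V' : Type*} [AddCommGroup V] [Module (ZMod 2) V] [AddCommGroup V']
  [Module (ZMod 2) V']

/-- `incl` identifies `ι'` with a segment of the ordered set `ι`, and `U` is the set of the elements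
above that segment. -/
structure IsSegmentInclusion [Preorder ι] [Preorder ι'] (incl : ι' → ι) (U : Set ι) : Prop where
  strictMono : StrictMono incl
  isUpperSet : IsUpperSet U
  isUpperSet_union : IsUpperSet (Set.range incl ∪ U)
  disjoint : Disjoint (Set.range incl) U

/-- The coordinates of `v` at the indices in the range of `incl` are the coordinates of `v'`, and
its coordinates in `U` vanish. Its coordinates below the segment are arbitrary: restriction
to the submodule `M^{≥ m}` forgets them. -/
def TruncatesTo (b : Basis ι (ZMod 2) V) (b' : Basis ι' (ZMod 2) V') (incl : ι' → ι) (U : Set ι)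
    (v : V) (v' : V') : Prop :=
  (∀ x, b'.repr v' x = b.repr v (incl x)) ∧ ∀ y ∈ U, b.repr v y = 0

variable {b : Basis ι (ZMod 2) V} {b' : Basis ι' (ZMod 2) V'} {incl : ι' → ι} {U : Set ι}

theorem exists_truncatesTo_left (b : Basis ι (ZMod 2) V) (hincl : Function.Injective incl)
    (hU : Disjoint (Set.range incl) U) (v' : V') : ∃ v, TruncatesTo b b' incl U v v' := by
  refine ⟨b.repr.symm ((b'.repr v').mapDomain incl), fun x => ?_, fun y hy => ?_⟩
  · rw [b.repr.apply_symm_apply, Finsupp.mapDomain_apply hincl]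
  · rw [b.repr.apply_symm_apply, Finsupp.mapDomain_of_notMem_range _ _ (hU.notMem_of_mem_right hy)]

theorem exists_truncatesTo_right (b' : Basis ι' (ZMod 2) V') (hincl : Function.Injective incl)
    {v : V} (hv : ∀ y ∈ U, b.repr v y = 0) : ∃ v', TruncatesTo b b' incl U v v' := by
  refine ⟨b'.repr.symm ((b.repr v).comapDomain incl hincl.injOn), fun x => ?_, hv⟩
  rw [b'.repr.apply_symm_apply, Finsupp.comapDomain_apply]

section Order

variable [LinearOrder ι] [LinearOrder ι'] {v : V} {v' : V'}

theorem IsLeadingTerm.repr_eq_zero_of_isUpperSet {x : ι} (hx : IsLeadingTerm b v x)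
    (hU : IsUpperSet U) (hxU : x ∉ U) : ∀ y ∈ U, b.repr v y = 0 := by
  intro y hy
  by_contra hne
  exact hxU (hU (hx.2 y hne) hy)

theorem TruncatesTo.isLeadingTerm_iff (hincl : IsSegmentInclusion incl U)
    (h : TruncatesTo b b' incl U v v') (x : ι') :
    IsLeadingTerm b' v' x ↔ IsLeadingTerm b v (incl x) := by
  refine and_congr (by rw [h.1]) ⟨fun hx y hy => ?_, fun hx y hy => ?_⟩
  · by_contra! hlt
    obtain ⟨y', rfl⟩ | hyU := hincl.isUpperSet_union hlt.le (Or.inl ⟨x, rfl⟩)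
    · exact (hincl.strictMono.lt_iff_lt.1 hlt).not_ge (hx y' (by rwa [h.1]))
    · exact hy (h.2 y hyU)
  · exact hincl.strictMono.le_iff_le.1 (hx _ (by rwa [← h.1]))

theorem IsLeadingTerm.truncatesTo_zero {y : ι} (hv : IsLeadingTerm b v y)
    (hincl : IsSegmentInclusion incl U) (hy : y ∉ Set.range incl ∪ U) :
    TruncatesTo b b' incl U v 0 := by
  have coord_eq_zero := hv.repr_eq_zero_of_isUpperSet hincl.isUpperSet_union hy
  refine ⟨fun x => ?_, fun z hz => coord_eq_zero z (Or.inr hz)⟩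
  rw [map_zero, Finsupp.zero_apply, coord_eq_zero _ (Or.inl ⟨x, rfl⟩)]

variable {κ κ' W W' : Type*} [LinearOrder κ] [AddCommGroup W] [Module (ZMod 2) W]
  [AddCommGroup W'] [Module (ZMod 2) W'] {c : Basis κ (ZMod 2) W} {c' : Basis κ' (ZMod 2) W'}
  {incl' : κ' → κ} {U' : Set κ} {f : V →ₗ[ZMod 2] W} {f' : V' →ₗ[ZMod 2] W'}
  (hincl : IsSegmentInclusion incl U)
  (hf : ∀ v v', TruncatesTo b b' incl U v v' → TruncatesTo c c' incl' U' (f v) (f' v'))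

include hincl hf

theorem LeadsTo.mem_range_union {y : κ'} {x : ι} (h : LeadsTo f b c (incl' y) x) :
    x ∈ Set.range incl ∪ U := by
  obtain ⟨v, hx, hy⟩ := h
  by_contra hxS
  refine hy.1 ?_
  rw [← (hf v 0 (hx.truncatesTo_zero hincl hxS)).1, map_zero, map_zero, Finsupp.zero_apply]

variable [LinearOrder κ'] (hincl' : IsSegmentInclusion incl' U')
include hincl'

theorem leadsTo_iff_of_truncatesTo (y : κ') (x : ι') :
    LeadsTo f' b' c' y x ↔ LeadsTo f b c (incl' y) (incl x) := by
  have hinj := hincl.strictMono.injective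
  constructor
  · rintro ⟨v', hx, hy⟩
    obtain ⟨v, hv⟩ := exists_truncatesTo_left (b' := b') b hinj hincl.disjoint v'
    exact ⟨v, (hv.isLeadingTerm_iff hincl x).1 hx,
      ((hf v v' hv).isLeadingTerm_iff hincl' y).1 hy⟩
  · rintro ⟨v, hx, hy⟩
    have hxU : incl x ∉ U := hincl.disjoint.notMem_of_mem_left ⟨x, rfl⟩
    obtain ⟨v', hv⟩ := exists_truncatesTo_right b' hinj
      (hx.repr_eq_zero_of_isUpperSet hincl.isUpperSet hxU)
    exact ⟨v', (hv.isLeadingTerm_iff hincl x).2 hx,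
      ((hf v v' hv).isLeadingTerm_iff hincl' y).2 hy⟩

theorem isTag_iff_of_truncatesTo (y : κ') (x : ι') :
    IsTag f' b' c' y x ↔ IsTag f b c (incl' y) (incl x) := by
  have key := leadsTo_iff_of_truncatesTo hincl hf hincl' y
  refine and_congr (key x) ⟨fun hmin x₀ h₀ => ?_, fun hmin x' h' => ?_⟩
  · by_contra! hlt
    rcases h₀.mem_range_union hincl hf with ⟨x', rfl⟩ | hU
    · exact (hincl.strictMono.lt_iff_lt.1 hlt).not_ge (hmin ((key x').2 h₀))
    · exact hincl.disjoint.notMem_of_mem_left ⟨x, rfl⟩ (hincl.isUpperSet hlt.le hU)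
  · exact hincl.strictMono.le_iff_le.1 (hmin ((key x').1 h'))

end Order

end TruncatesTo

section TruncationModule

variable {M κ : Type*} [AddCommGroup M] [Module (ZMod 2) M] [Module SteenrodAlgebra M]
  [IsScalarTower (ZMod 2) SteenrodAlgebra M] {𝓜 : ℤ → Submodule (ZMod 2) M}
  {dim : κ → ℤ}

section Cells

variable {e : κ → M} (he : ∀ k, e k ∈ 𝓜 (dim k)) (m n : ℤ)

/-- The elements `e k` of `M^{≥ m}` with `m ≤ dim k`. -/
def degreeGECell (k : {k // m ≤ dim k}) : degreeGE 𝓜 m :=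
  ⟨e k, mem_degreeGE 𝓜 k.2 (he k)⟩

/-- The projection of `M^{≥ m}` to the truncation. -/
def truncationProj (𝓜 : ℤ → Submodule (ZMod 2) M) (m n : ℤ) :
    degreeGE 𝓜 m →ₗ[SteenrodAlgebra] Truncation 𝓜 m n :=
  ((degreeGE 𝓜 (n + 1)).submoduleOf (degreeGE 𝓜 m)).mkQ

variable {m n}

omit [IsScalarTower (ZMod 2) SteenrodAlgebra M] in
theorem truncationProj_degreeGECell (k : CellsBetween dim m n) :
    truncationProj 𝓜 m n (degreeGECell he m ⟨k, k.2.1⟩) = truncationVec 𝓜 e dim he m n k :=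
  rfl

omit [IsScalarTower (ZMod 2) SteenrodAlgebra M] in
theorem truncationProj_degreeGECell_of_lt {k : {k // m ≤ dim k}} (hk : n < dim k) :
    truncationProj 𝓜 m n (degreeGECell he m k) = 0 :=
  (Submodule.Quotient.mk_eq_zero _).2 (mem_degreeGE 𝓜 (Int.add_one_le_iff.2 hk) (he k))

theorem truncationVec_mem (k : CellsBetween dim m n) :
    truncationVec 𝓜 e dim he m n k ∈ truncationGrading 𝓜 m n (dim k) :=
  ⟨degreeGECell he m ⟨k, k.2.1⟩, he k, rfl⟩

theorem map_subtype_span_degreeGECell (s : Set {k // m ≤ dim k}) :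
    (Submodule.span (ZMod 2) (degreeGECell he m '' s)).map
      ((degreeGE 𝓜 m).subtype.restrictScalars (ZMod 2)) =
      Submodule.span (ZMod 2) (e '' (Subtype.val '' s)) := by
  rw [Submodule.map_span, Set.image_image, Set.image_image]
  rfl

theorem isCellular_degreeGECell [Preorder κ] (hcell : IsCellular e) (hdim : Monotone dim) :
    IsCellular (degreeGECell he m) := by
  intro k i hi
  have hIoi : Set.Ioi k.1 ⊆ Subtype.val '' Set.Ioi k := fun l hl =>
    ⟨⟨l, k.2.trans (hdim (le_of_lt hl))⟩, hl, rfl⟩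
  have hmem : Sq i • e k ∈ Submodule.span (ZMod 2) (e '' (Subtype.val '' Set.Ioi k)) :=
    Submodule.span_mono (Set.image_mono hIoi) (hcell k i hi)
  rw [← map_subtype_span_degreeGECell he] at hmem
  obtain ⟨u, hu, hue⟩ := hmem
  rwa [show Sq i • degreeGECell he m k = u from Subtype.ext hue.symm]

end Cells

variable (h𝓜 : IsGradedSteenrodModule 𝓜) {e : Basis κ (ZMod 2) M} (he : ∀ k, e k ∈ 𝓜 (dim k))
  {m n : ℤ}

include h𝓜 he

theorem degreeGE_eq_span : (degreeGE 𝓜 m).restrictScalars (ZMod 2) =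
    Submodule.span (ZMod 2) (e '' {k | m ≤ dim k}) := by
  apply le_antisymm
  · rw [degreeGE_eq_iSup h𝓜]
    refine iSup_le fun p x hx => e.mem_span_image.2 fun k hk => ?_
    by_contra hkm
    exact Finsupp.mem_support_iff.1 hk (repr_eq_zero_of_mem e dim h𝓜.isInternal he hx
      ((not_le.1 hkm).trans_le p.2).ne)
  · rw [Submodule.span_le]
    rintro _ ⟨k, hk, rfl⟩
    exact mem_degreeGE 𝓜 hk (he k)

theorem mem_degreeGE_iff {x : M} : x ∈ degreeGE 𝓜 m ↔ ∀ k, dim k < m → e.repr x k = 0 := by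
  rw [← Submodule.restrictScalars_mem (ZMod 2), degreeGE_eq_span h𝓜 he, Basis.mem_span_image]
  refine forall_congr' fun k => ?_
  rw [Finset.mem_coe, Finsupp.mem_support_iff, Set.mem_ofPred_eq, ← not_lt, not_imp_not]

theorem span_degreeGECell :
    ⊤ ≤ Submodule.span (ZMod 2) (Set.range (degreeGECell (e := e) he m)) := by
  rintro u -
  have hu : u.1 ∈ (degreeGE 𝓜 m).restrictScalars (ZMod 2) := u.2
  rw [degreeGE_eq_span h𝓜 he, ← Subtype.range_coe_subtype, ← Set.image_univ,
    ← map_subtype_span_degreeGECell he, Set.image_univ] at hu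
  obtain ⟨u', hu', huu'⟩ := hu
  rwa [show u = u' from Subtype.ext huu'.symm]

variable (𝓜 e dim m n) in
omit h𝓜 he in
/-- The coordinates of an element of `M^{≥ m}` at the cells in dimensions `m` through `n`. -/
def truncationCoord : degreeGE 𝓜 m →ₗ[ZMod 2] CellsBetween dim m n →₀ ZMod 2 :=
  Finsupp.lcomapDomain Subtype.val Subtype.val_injective ∘ₗ e.repr.toLinearMap ∘ₗ
    (degreeGE 𝓜 m).subtype.restrictScalars (ZMod 2)

theorem ker_truncationCoord : LinearMap.ker (truncationCoord 𝓜 dim e m n) =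
    ((degreeGE 𝓜 (n + 1)).submoduleOf (degreeGE 𝓜 m)).restrictScalars (ZMod 2) := by
  ext u
  have hu : u ∈ (degreeGE 𝓜 (n + 1)).submoduleOf (degreeGE 𝓜 m) ↔
      ∀ k, dim k < n + 1 → e.repr u k = 0 := mem_degreeGE_iff h𝓜 he
  rw [LinearMap.mem_ker, Submodule.restrictScalars_mem, hu, Finsupp.ext_iff]
  refine ⟨fun h k hk => ?_, fun h k => h k (Int.lt_add_one_iff.2 k.2.2)⟩
  rcases lt_or_ge (dim k) m with hkm | hkm
  · exact (mem_degreeGE_iff h𝓜 he).1 u.2 k hkm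
  · exact h ⟨k, hkm, Int.lt_add_one_iff.1 hk⟩

theorem truncationCoord_surjective : Function.Surjective (truncationCoord 𝓜 dim e m n) := by
  intro l
  have hl : e.repr.symm (l.mapDomain Subtype.val) ∈ degreeGE 𝓜 m := by
    refine (mem_degreeGE_iff h𝓜 he).2 fun k hk => ?_
    rw [e.repr.apply_symm_apply, Finsupp.mapDomain_of_notMem_range]
    rintro ⟨k, rfl⟩
    exact hk.not_ge k.2.1
  refine ⟨⟨_, hl⟩, Finsupp.ext fun k => ?_⟩
  change e.repr (e.repr.symm (l.mapDomain Subtype.val)) k = l k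
  rw [e.repr.apply_symm_apply, Finsupp.mapDomain_apply Subtype.val_injective]

/-- The classes of the `e k` as a basis of the truncation. -/
def truncationBasis : Basis (CellsBetween dim m n) (ZMod 2) (Truncation 𝓜 m n) :=
  .ofRepr <| (Submodule.Quotient.restrictScalarsEquiv (ZMod 2)
      ((degreeGE 𝓜 (n + 1)).submoduleOf (degreeGE 𝓜 m))).symm ≪≫ₗ
    Submodule.quotEquivOfEq _ _ (ker_truncationCoord h𝓜 he).symm ≪≫ₗ
    (truncationCoord 𝓜 dim e m n).quotKerEquivOfSurjective (truncationCoord_surjective h𝓜 he)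

theorem truncationBasis_repr (u : degreeGE 𝓜 m) (k : CellsBetween dim m n) :
    (truncationBasis h𝓜 he).repr (truncationProj 𝓜 m n u) k = e.repr u.1 k :=
  rfl

theorem coe_truncationBasis : ⇑(truncationBasis (m := m) (n := n) h𝓜 he) =
    truncationVec 𝓜 e dim he m n := by
  classical
  ext1 k
  refine (truncationBasis h𝓜 he).repr.injective (Finsupp.ext fun l => ?_)
  rw [Basis.repr_self, ← truncationProj_degreeGECell, truncationBasis_repr]
  simp only [degreeGECell, Basis.repr_self, Finsupp.single_apply, Subtype.ext_iff]

theorem truncationBasis_mem (k : CellsBetween dim m n) :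
    truncationBasis h𝓜 he k ∈ truncationGrading 𝓜 m n (dim k) := by
  rw [coe_truncationBasis]
  exact truncationVec_mem he k

theorem isGradedSteenrodModule_truncationGrading :
    IsGradedSteenrodModule (truncationGrading 𝓜 m n) where
  isInternal := by
    refine isInternal_of_basis (truncationBasis h𝓜 he) (fun k => dim k)
      (truncationBasis_mem h𝓜 he) ?_
    rintro p _ ⟨u, hu, rfl⟩ k hk
    exact (truncationBasis_repr h𝓜 he u k).trans
      (repr_eq_zero_of_mem e dim h𝓜.isInternal he hu hk)
  sq_smul_mem i p := by
    rintro _ ⟨u, hu, rfl⟩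
    exact ⟨Sq i • u, h𝓜.sq_smul_mem i p u.1 hu, rfl⟩

theorem isCellular_truncationBasis [LinearOrder κ] (hdim : Monotone dim) :
    IsCellular (truncationBasis (m := m) (n := n) h𝓜 he) :=
  isCellular_of_monotone (isGradedSteenrodModule_truncationGrading h𝓜 he) _
    (hdim.comp (Subtype.mono_coe _)) (truncationBasis_mem h𝓜 he)

end TruncationModule

section Pullback

variable {M N F : Type*} [AddCommGroup M] [Module (ZMod 2) M] [Module SteenrodAlgebra M]
  [IsScalarTower (ZMod 2) SteenrodAlgebra M] [AddCommGroup N] [Module (ZMod 2) N]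
  [Module SteenrodAlgebra N] [IsScalarTower (ZMod 2) SteenrodAlgebra N]

theorem cartanSq_rTensor [AddCommGroup F] [Module (ZMod 2) F] [Module SteenrodAlgebra F]
    [IsScalarTower (ZMod 2) SteenrodAlgebra F] (g : N →ₗ[SteenrodAlgebra] M) (n : ℕ)
    (z : N ⊗[ZMod 2] F) :
    LinearMap.rTensor F (g.restrictScalars (ZMod 2)) (cartanSq N F n z) =
      cartanSq M F n (LinearMap.rTensor F (g.restrictScalars (ZMod 2)) z) := by
  induction z using TensorProduct.induction_on with
  | zero => simp only [map_zero]
  | tmul x y => simp [cartanSq, LinearMap.sum_apply]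
  | add x y hx hy => simp only [map_add, hx, hy]

variable {L : Type*} [AddCommGroup L] [Module (ZMod 2) L] [Module SteenrodAlgebra L]
  {𝓛 : ℤ → Submodule (ZMod 2) L} {𝓜 : ℤ → Submodule (ZMod 2) M}
  {F : GradedFreeResolution.{v, w} 𝓛} {t : ℤ} {i : ℕ}

/-- The `𝒜`-linear map `f ∘ (g ⊗ 1)` on `N ⊗ F_i`, for an `𝒜`-linear map `g : N → M` and an element
`f` of `Hom_𝒜^t(M ⊗ F_i, 𝔽₂)`. -/
def diagonalPullback (g : N →ₗ[SteenrodAlgebra] M) (f : diagonalHom 𝓜 F t i) :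
    DiagonalTensor N (F.obj i) →ₗ[SteenrodAlgebra] ZMod 2 :=
  steenrodLinear (f.1 ∘ₗ LinearMap.rTensor (F.obj i) (g.restrictScalars (ZMod 2)) ∘ₗ
    (DiagonalTensor.equiv N (F.obj i)).toLinearMap) fun n z =>
      (congrArg (fun z => f.1 (LinearMap.rTensor (F.obj i) (g.restrictScalars (ZMod 2)) z))
        (DiagonalTensor.Sq_smul N (F.obj i) n z)).trans
      ((congrArg f.1 (cartanSq_rTensor g n _)).trans (f.2.1 n _))

theorem diagonalPullback_tmul (g : N →ₗ[SteenrodAlgebra] M) (f : diagonalHom 𝓜 F t i) (x : N)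
    (y : F.obj i) : diagonalPullback g f (DiagonalTensor.tmul x y) = f.1 (g x ⊗ₜ y) :=
  rfl

theorem diagonalPullback_diagonalHomD (g : N →ₗ[SteenrodAlgebra] M) (f : diagonalHom 𝓜 F t i) :
    diagonalPullback g (diagonalHomD 𝓜 F t i f) =
      diagonalPullback g f ∘ₗ DiagonalTensor.lTensor N (F.d i) := by
  ext z
  induction z using DiagonalTensor.induction_on with
  | zero => simp only [map_zero]
  | tmul x y => rfl
  | add x y hx hy => simp only [map_add, hx, hy]

end Pullback

section TensorIndex

variable {L : Type*} [AddCommGroup L] [Module (ZMod 2) L] [Module SteenrodAlgebra L]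
  {𝓛 : ℤ → Submodule (ZMod 2) L} {F : GradedFreeResolution.{v, w} 𝓛} {κ : Type*} {dim : κ → ℤ}
  {m n t : ℤ} {i s : ℕ}

variable (F dim m n t i) in
/-- The indices of the `e_k ⊗ r_{i,j}` that come from the cells of `M^{≥ m}` that vanish in the
truncation. -/
def TensorIndex.above : Set (TensorIndex dim F t i) :=
  {y | m ≤ dim (ofLex y.1).1 ∧ n < dim (ofLex y.1).1}

theorem TensorIndex.mem_range_incl (y : TensorIndex dim F t i) :
    y ∈ Set.range (TensorIndex.incl :
      TensorIndex (fun k : CellsBetween dim m n => dim k) F t i → _) ↔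
      m ≤ dim (ofLex y.1).1 ∧ dim (ofLex y.1).1 ≤ n := by
  constructor
  · rintro ⟨x, rfl⟩
    exact (ofLex x.1).1.2
  · intro h
    exact ⟨⟨toLex (⟨(ofLex y.1).1, h⟩, (ofLex y.1).2), y.2⟩, rfl⟩

theorem CurtisItem.Mentions.incl
    {a : TensorIndex (fun k : CellsBetween dim m n => dim k) F t (i + 1)}
    {b : TensorIndex (fun k : CellsBetween dim m n => dim k) F t i}
    {x : TensorIndex (fun k : CellsBetween dim m n => dim k) F t s}
    (h : CurtisItem.Mentions (ι := TensorIndex (fun k : CellsBetween dim m n => dim k) F t)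
      (CurtisItem.tag a b) ⟨s, x⟩) :
    CurtisItem.Mentions (ι := TensorIndex dim F t) (CurtisItem.tag a.incl b.incl)
      ⟨s, x.incl⟩ := by
  rcases h with h | h <;> cases h
  exacts [Or.inl rfl, Or.inr rfl]

variable [LinearOrder κ] [∀ i, LinearOrder (F.idx i)]

theorem TensorIndex.strictMono_incl : StrictMono
    (TensorIndex.incl : TensorIndex (fun k : CellsBetween dim m n => dim k) F t i → _) := by
  intro x y hxy
  rw [← Subtype.coe_lt_coe, Prod.Lex.lt_iff] at hxy ⊢
  exact hxy.imp_right fun h => ⟨congrArg Subtype.val h.1, h.2⟩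

theorem TensorIndex.monotone_dim (hdim : Monotone dim) :
    Monotone fun y : TensorIndex dim F t i => dim (ofLex y.1).1 :=
  fun x y hxy => hdim (Prod.Lex.monotone_fst x.1 y.1 hxy)

theorem TensorIndex.isSegmentInclusion_incl (hdim : Monotone dim) : IsSegmentInclusion
    (TensorIndex.incl : TensorIndex (fun k : CellsBetween dim m n => dim k) F t i → _)
    (TensorIndex.above F dim m n t i) where
  strictMono := strictMono_incl
  isUpperSet _ _ hxy hx :=
    ⟨hx.1.trans (monotone_dim hdim hxy), hx.2.trans_le (monotone_dim hdim hxy)⟩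
  isUpperSet_union := by
    have hunion : ∀ y : TensorIndex dim F t i, y ∈ Set.range
        (TensorIndex.incl : TensorIndex (fun k : CellsBetween dim m n => dim k) F t i → _) ∪
        TensorIndex.above F dim m n t i ↔ m ≤ dim (ofLex y.1).1 := fun y => by
      rw [Set.mem_union, mem_range_incl, above, Set.mem_ofPred_eq, ← and_or_left]
      exact and_iff_left (le_or_gt _ n)
    intro x y hxy hx
    rw [hunion] at hx ⊢
    exact hx.trans (monotone_dim hdim hxy)
  disjoint := Set.disjoint_left.2 fun y hy hy' => ((mem_range_incl y).1 hy).2.not_gt hy'.2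

end TensorIndex

theorem IsDualBasis.repr_apply {M L κ : Type*} [AddCommGroup M] [Module (ZMod 2) M]
    [Module SteenrodAlgebra M] [IsScalarTower (ZMod 2) SteenrodAlgebra M] [AddCommGroup L]
    [Module (ZMod 2) L] [Module SteenrodAlgebra L] {𝓛 : ℤ → Submodule (ZMod 2) L}
    {𝓜 : ℤ → Submodule (ZMod 2) M} {e : κ → M} {dim : κ → ℤ}
    {F : GradedFreeResolution.{v, w} 𝓛} {t : ℤ}
    {B : ∀ i, Basis (TensorIndex dim F t i) (ZMod 2) (diagonalHom 𝓜 F t i)}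
    (hB : IsDualBasis e dim B) {i : ℕ} (f : diagonalHom 𝓜 F t i) (x : TensorIndex dim F t i) :
    (B i).repr f x = f.1 (e (ofLex x.1).1 ⊗ₜ F.gen i (ofLex x.1).2) := by
  classical
  let eval : diagonalHom 𝓜 F t i →ₗ[ZMod 2] ZMod 2 :=
    LinearMap.applyₗ (e (ofLex x.1).1 ⊗ₜ[ZMod 2] F.gen i (ofLex x.1).2) ∘ₗ
      (diagonalHom 𝓜 F t i).subtype
  have coord_eq_eval : (B i).coord x = eval := (B i).ext fun y => by
    rw [Basis.coord_apply, Basis.repr_self, Finsupp.single_apply]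
    obtain ⟨h1, h0⟩ := hB i y (ofLex x.1).1 (ofLex x.1).2
    split_ifs with hyx
    · exact (h1 (congrArg Subtype.val hyx)).symm
    · exact (h0 fun h => hyx (Subtype.ext h)).symm
  exact LinearMap.congr_fun coord_eq_eval f

section TruncationTable

variable {M κ L : Type*} [AddCommGroup M] [Module (ZMod 2) M] [Module SteenrodAlgebra M]
  [IsScalarTower (ZMod 2) SteenrodAlgebra M] {𝓜 : ℤ → Submodule (ZMod 2) M}
  (h𝓜 : IsGradedSteenrodModule 𝓜) [LinearOrder κ] [WellFoundedGT κ] {e : Basis κ (ZMod 2) M}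
  {dim : κ → ℤ} (he : ∀ k, e k ∈ 𝓜 (dim k)) (hdim : Monotone dim) [AddCommGroup L]
  [Module (ZMod 2) L] [Module SteenrodAlgebra L] {𝓛 : ℤ → Submodule (ZMod 2) L}
  {F : GradedFreeResolution.{v, w} 𝓛} {m n t : ℤ}

include h𝓜 hdim in
theorem diagonalPullback_ext {i : ℕ} {g g' : DiagonalTensor (degreeGE 𝓜 m) (F.obj i)
      →ₗ[SteenrodAlgebra] ZMod 2}
    (h : ∀ k j, g (DiagonalTensor.tmul (degreeGECell he m k) (F.gen i j)) =
      g' (DiagonalTensor.tmul (degreeGECell he m k) (F.gen i j))) : g = g' :=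
  LinearMap.ext_on_range (DiagonalTensor.span_tmul_eq_top
    (isCellular_degreeGECell he (isCellular_of_monotone h𝓜 e hdim he) hdim)
    (span_degreeGECell h𝓜 he) (F.gen i).span_eq.ge) fun p => h p.1 p.2

variable {B : ∀ i, Basis (TensorIndex dim F t i) (ZMod 2) (diagonalHom 𝓜 F t i)}
  {B' : ∀ i, Basis (TensorIndex (fun k : CellsBetween dim m n => dim k) F t i) (ZMod 2)
    (diagonalHom (truncationGrading 𝓜 m n) F t i)}
  (hB : IsDualBasis e dim B)
  (hB' : IsDualBasis (truncationVec 𝓜 e dim he m n) (fun k : CellsBetween dim m n => dim k) B')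

include h𝓜 hdim hB hB'

theorem truncatesTo_iff_diagonalPullback_eq {i : ℕ} (f : diagonalHom 𝓜 F t i)
    (f' : diagonalHom (truncationGrading 𝓜 m n) F t i) :
    TruncatesTo (B i) (B' i) TensorIndex.incl (TensorIndex.above F dim m n t i) f f' ↔
      diagonalPullback (degreeGE 𝓜 m).subtype f = diagonalPullback (truncationProj 𝓜 m n) f' := by
  constructor
  · rintro ⟨coord_eq, coord_eq_zero⟩
    refine diagonalPullback_ext h𝓜 he hdim fun k j => ?_
    rw [diagonalPullback_tmul, diagonalPullback_tmul]
    by_cases hn : dim k ≤ n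
    · let k' : CellsBetween dim m n := ⟨k, k.2, hn⟩
      by_cases ht : dim k + F.deg i j = t
      · have := coord_eq ⟨toLex (k', j), ht⟩
        rw [hB.repr_apply, hB'.repr_apply] at this
        exact this.symm
      · exact (f.2.2 _ _ ht _ (he k) _ (F.gen_mem i j)).trans
          (f'.2.2 _ _ ht _ (truncationVec_mem he k') _ (F.gen_mem i j)).symm
    · rw [truncationProj_degreeGECell_of_lt he (not_le.1 hn), TensorProduct.zero_tmul, map_zero]
      by_cases ht : dim k + F.deg i j = t
      · exact (hB.repr_apply f ⟨toLex (k.1, j), ht⟩).symm.trans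
          (coord_eq_zero _ ⟨k.2, not_le.1 hn⟩)
      · exact f.2.2 _ _ ht _ (he k) _ (F.gen_mem i j)
  · intro h
    have hcell : ∀ k j, f.1 (e k.1 ⊗ₜ F.gen i j) =
        f'.1 (truncationProj 𝓜 m n (degreeGECell he m k) ⊗ₜ F.gen i j) := fun k j =>
      LinearMap.congr_fun h (DiagonalTensor.tmul (degreeGECell he m k) (F.gen i j))
    refine ⟨fun x => ?_, fun y hy => ?_⟩
    · rw [hB.repr_apply, hB'.repr_apply]
      exact (hcell ⟨_, (ofLex x.1).1.2.1⟩ _).symm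
    · rw [hB.repr_apply, hcell ⟨_, hy.1⟩, truncationProj_degreeGECell_of_lt he hy.2,
        TensorProduct.zero_tmul, map_zero]

theorem truncatesTo_diagonalHomD {i : ℕ} (f : diagonalHom 𝓜 F t i)
    (f' : diagonalHom (truncationGrading 𝓜 m n) F t i)
    (h : TruncatesTo (B i) (B' i) TensorIndex.incl (TensorIndex.above F dim m n t i) f f') :
    TruncatesTo (B (i + 1)) (B' (i + 1)) TensorIndex.incl
      (TensorIndex.above F dim m n t (i + 1)) (diagonalHomD 𝓜 F t i f)
      (diagonalHomD (truncationGrading 𝓜 m n) F t i f') := by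
  rw [truncatesTo_iff_diagonalPullback_eq h𝓜 he hdim hB hB'] at h ⊢
  rw [diagonalPullback_diagonalHomD, diagonalPullback_diagonalHomD, h]

variable [∀ i, LinearOrder (F.idx i)] [∀ i, WellFoundedLT (TensorIndex dim F t i)]
  {T : ∀ i, Set (CurtisItem (TensorIndex dim F t) i)} (hT : IsDiagonalCurtisTable B T)
  {T' : ∀ i, Set (CurtisItem (TensorIndex (fun k : CellsBetween dim m n => dim k) F t) i)}
  (hT' : IsDiagonalCurtisTable B' T')

include hT hT'

theorem tag_mem_truncation_iff {i : ℕ}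
    (a : TensorIndex (fun k : CellsBetween dim m n => dim k) F t (i + 1))
    (b : TensorIndex (fun k : CellsBetween dim m n => dim k) F t i) :
    CurtisItem.tag a b ∈ T' (i + 1) ↔ CurtisItem.tag a.incl b.incl ∈ T (i + 1) := by
  have (i : ℕ) : WellFoundedLT (TensorIndex (fun k : CellsBetween dim m n => dim k) F t i) :=
    TensorIndex.strictMono_incl.wellFoundedLT
  rw [hT.tag_iff, hT'.tag_iff]
  exact isTag_iff_of_truncatesTo (TensorIndex.isSegmentInclusion_incl hdim)
    (truncatesTo_diagonalHomD h𝓜 he hdim hB hB') (TensorIndex.isSegmentInclusion_incl hdim) a b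

theorem single_mem_truncation_iff {s : ℕ}
    (x : TensorIndex (fun k : CellsBetween dim m n => dim k) F t s) :
    CurtisItem.single x ∈ T' s ↔ NotInSurvivingTag T x := by
  rw [hT'.single_iff_not_mentions]
  simp only [tag_mem_truncation_iff h𝓜 he hdim hB hB' hT hT', NotInSurvivingTag]

omit h𝓜 hdim hB hB' hT' [WellFoundedGT κ] [∀ i, WellFoundedLT (TensorIndex dim F t i)] in
theorem notInSurvivingTag_of_single_mem {s : ℕ}
    {x : TensorIndex (fun k : CellsBetween dim m n => dim k) F t s}
    (hx : CurtisItem.single x.incl ∈ T s) : NotInSurvivingTag T x := by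
  rintro ⟨i, a, b, hab, hx_mem⟩
  exact (hT.single_iff_not_mentions x.incl).1 hx ⟨i, a.incl, b.incl, hab, hx_mem.incl⟩

end TruncationTable

theorem diagonalHomD_diagonalHomD {M L : Type*} [AddCommGroup M] [Module (ZMod 2) M]
    [Module SteenrodAlgebra M] [IsScalarTower (ZMod 2) SteenrodAlgebra M] [AddCommGroup L]
    [Module (ZMod 2) L] [Module SteenrodAlgebra L] {𝓛 : ℤ → Submodule (ZMod 2) L}
    (𝓜 : ℤ → Submodule (ZMod 2) M) (F : GradedFreeResolution.{v, w} 𝓛) (t : ℤ) (i : ℕ)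
    (f : diagonalHom 𝓜 F t i) : diagonalHomD 𝓜 F t (i + 1) (diagonalHomD 𝓜 F t i f) = 0 := by
  refine Subtype.ext (TensorProduct.ext' fun x y => ?_)
  change f.1 (x ⊗ₜ F.d i (F.d (i + 1) y)) = 0
  rw [(F.exact i _).2 ⟨y, rfl⟩, TensorProduct.tmul_zero, map_zero]

end

theorem mainTheorem5
    {M : Type*} [AddCommGroup M] [Module (ZMod 2) M] [Module SteenrodAlgebra M]
    [IsScalarTower (ZMod 2) SteenrodAlgebra M]
    (𝓜 : ℤ → Submodule (ZMod 2) M) (h𝓜 : IsGradedSteenrodModule 𝓜)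
    {κ : Type*} [Finite κ] [LinearOrder κ]
    (e : Module.Basis κ (ZMod 2) M) (dim : κ → ℤ) (he : ∀ k, e k ∈ 𝓜 (dim k))
    (hdim : Monotone dim)
    (F : GradedFreeResolution trivialGrading) [∀ i, LinearOrder (F.idx i)]
    (hF : ∀ (i : ℕ) (q : ℤ), {j : F.idx i | F.deg i j = q}.Finite)
    (m n t : ℤ) :
    ∃ (B : ∀ i, Module.Basis (TensorIndex dim F t i) (ZMod 2) (diagonalHom 𝓜 F t i))
      (B' : ∀ i, Module.Basis (TensorIndex (fun k : CellsBetween dim m n => dim k) F t i) (ZMod 2)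
        (diagonalHom (truncationGrading 𝓜 m n) F t i)),
      IsDualBasis e dim B ∧
      IsDualBasis (truncationVec 𝓜 e dim he m n) (fun k : CellsBetween dim m n => dim k) B' ∧
      (∃! T, IsDiagonalCurtisTable B T) ∧
      (∃! T', IsDiagonalCurtisTable B' T') ∧
      ∀ T T', IsDiagonalCurtisTable B T →
        IsDiagonalCurtisTable B' T' →
        -- the tags of the truncation are the tags of `T` that lie in the range
        (∀ (i : ℕ) (a : TensorIndex (fun k : CellsBetween dim m n => dim k) F t (i + 1))
            (b : TensorIndex (fun k : CellsBetween dim m n => dim k) F t i),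
          CurtisItem.tag a b ∈ T' (i + 1) ↔ CurtisItem.tag a.incl b.incl ∈ T (i + 1)) ∧
        -- its untagged items are the items in the range that appear in no surviving tag
        (∀ (s : ℕ) (x : TensorIndex (fun k : CellsBetween dim m n => dim k) F t s),
          CurtisItem.single x ∈ T' s ↔ NotInSurvivingTag T x) ∧
        -- these include the untagged items of `T` in the range
        (∀ (s : ℕ) (x : TensorIndex (fun k : CellsBetween dim m n => dim k) F t s),
          CurtisItem.single x.incl ∈ T s → CurtisItem.single x ∈ T' s) ∧
        -- cocycles led by these items represent a basis of the cohomology of the complex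
        (∀ (s : ℕ) (z : {x : TensorIndex (fun k : CellsBetween dim m n => dim k) F t s //
              NotInSurvivingTag T x} →
              DiagonalCocycles (truncationGrading 𝓜 m n) F t s),
          (∀ x, IsLeadingTerm (B' s) (z x).1 x.1) →
          ∃ b : Module.Basis {x : TensorIndex (fun k : CellsBetween dim m n => dim k) F t s //
              NotInSurvivingTag T x} (ZMod 2)
              (DiagonalCohomology (truncationGrading 𝓜 m n) F t s),
            ∀ x, b x = cohomologyClass (X := fun i => ↥(diagonalHom (truncationGrading 𝓜 m n) F t i))
              (diagonalHomD (truncationGrading 𝓜 m n) F t) s (z x)) ∧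
        -- and they count a basis of the Adams `E_2`-term `Ext^{s,t}` of the truncation
        (∀ (P : GradedFreeResolution (truncationGrading 𝓜 m n)) (s : ℕ),
          Nonempty (SteenrodExt P s t ≃ₗ[ZMod 2]
            ({x : TensorIndex (fun k : CellsBetween dim m n => dim k) F t s //
              NotInSurvivingTag T x} →₀ ZMod 2))) := by
  have hcell := isCellular_of_monotone h𝓜 e hdim he
  have hN := isGradedSteenrodModule_truncationGrading (m := m) (n := n) h𝓜 he
  have hcell' := isCellular_truncationBasis (m := m) (n := n) h𝓜 he hdim
  have he' := truncationBasis_mem (m := m) (n := n) h𝓜 he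
  have := finite_tensorIndex dim F hF t
  have := finite_tensorIndex (fun k : CellsBetween dim m n => dim k) F hF t
  have hB := isDualBasis_diagonalHomBasis h𝓜 hcell he F t
  have hB' := isDualBasis_diagonalHomBasis hN hcell' he' F t
  rw [coe_truncationBasis] at hB'
  have hd := diagonalHomD_diagonalHomD 𝓜 F t
  have hd' := diagonalHomD_diagonalHomD (truncationGrading 𝓜 m n) F t
  refine ⟨_, _, hB, hB', existsUnique_isCurtisTable hd, existsUnique_isCurtisTable hd',
    fun T T' hT hT' => ?_⟩
  have single_mem_iff s := single_mem_truncation_iff h𝓜 he hdim hB hB' hT hT' (s := s)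
  have survives_iff s x := (single_mem_iff s x).symm.trans (hT'.single_iff x)
  refine ⟨fun i => tag_mem_truncation_iff h𝓜 he hdim hB hB' hT hT', single_mem_iff,
    fun s x hx => (single_mem_iff s x).2 (notInSurvivingTag_of_single_mem hT hx),
    fun s => exists_basis_cohomology hd' (survives_iff s), fun P s => ?_⟩
  obtain ⟨f⟩ := nonempty_steenrodExt_equiv_diagonalCohomology hN hcell' he' F t P s
  obtain ⟨g⟩ := nonempty_cohomology_equiv_finsupp hd' (survives_iff s)
  exact ⟨f.trans g⟩
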